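/- **Setting.** Let $\bar\rho\ge 0$ and let $\epsilon:[\bar\rho,\infty)\to[0,\infty)$ be a $C^1$ function with $\epsilon(\rho)=0$ iff $\rho=\bar\rho$. Put $p(\rho)=\rho\,\epsilon'(\rho)-\epsilon(\rho)$ and assume that $p$ is $C^1$ and $p\ge 0$, that for some $\rho_1\ge\bar\rho$ one has $p(\rho)>0$ and $dp/d\rho>0$ for all $\rho>\rho_1$, and that $dp/d\rho>0$ at every $\rho\in(\bar\rho,\rho_1]$ with $p(\rho)>0$ (so $p$ may vanish on part of the bounded interval $[\bar\rho,\rho_1]$). Consider a spherically symmetric perfect fluid with this equation of state in area-radius coordinates $(r,R)$, $0<R\le r<r_{\max}$, where $r$ labels the shells, $R$ is the area radius and the initial surface is $R=r$. The fields are the Misner–Sharp mass $\Psi(r,R)$, the matter density $\rho(r,R)\ge\bar\rho$ and a positive continuous function $E(r)$; write $\epsilon(r,R)=\epsilon(\rho(r,R))$, $p(r,R)=p(\rho(r,R))$ and $$R'=\frac{\Psi_{,r}}{4\pi R^2(\epsilon+p)},\qquad Y=\frac{E\,\Psi_{,r}}{(d\epsilon/d\rho)(\rho)},\qquad u^2=\frac{2\Psi}{R}+Y^2-1,\quad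 u\ge 0,\qquad e^{\nu}=\Big(\frac{d\epsilon}{d\rho}(\rho)\Big)^{-1}.$$ The comoving time at which the shell $r$ has area radius $R$ is $t(r,R)=\int_R^r \frac{e^{-\nu}}{u}(r,\sigma)\,d\sigma$, and $t_s(r)=t(r,0)$. Assume that * $\Psi$ is analytic at $(0,0)$ and odd, $\Psi(-r,-R)=-\Psi(r,R)$ near $(0,0)$; * $p=-\Psi_{,R}/(4\pi R^2)$ (field equation), $0<p\le\epsilon$ (positive pressure, dominant energy condition) and $\Psi_{,r}>0$ (no shell crossing) for $0<R\le r<r_{\max}$; and $u^2>0$ for $0<R<r<r_{\max}$; * $R'(r,r)=1$ for $0<r<r_{\max}$; $\lim_{r\to0^+}Y(r,xr)=1$ for every $x\in(0,1]$ (regular centre); and $\rho(r,R)\to\infty$ as $R\to0^+$ for every $r\in(0,r_{\max})$. (The remaining, second-order, Einstein equation for $\Psi$ is not required; the result holds whether or not it is imposed.) **Theorem.** Suppose that 1. the central singularity forms in a finite comoving time: $e^{-\nu}/u$ is integrable in $\sigma$ on $(0,r)$ for every $r\in(0,r_{\max})$, and $\lim_{r\to0^+}t_s(r)=t_0\in(0,\infty)$;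 2. there is $h>0$ such that $$\Psi(r,R)=\frac h2\Big(r^3-\frac{p_0}{\epsilon_0+p_0}R^3\Big)+o\big(|(r,R)|^3\big)\quad\text{as }(r,R)\to(0,0),$$ where $\epsilon_0=\lim_{r\to0^+}\epsilon(r,r)\in(0,\infty)$ and $p_0=\lim_{r\to0^+}p(r,r)\in(0,\infty)$. Then for some $r_0\in(0,r_{\max}]$ the apparent horizon $R_h(r)$, the unique $R\in(0,r]$ with $R=2\Psi(r,R)$, exists for $0<r<r_0$, and there is a solution $R_g$ on $(0,r_0)$, with $0<R_g(r)<r$, of the equation of radial null geodesics $$\frac{dR}{dr}=R'\Big(1-\frac uY\Big)$$ which extends back to the central singularity, i.e. $R_g(r)\to0$ and $t(r,R_g(r))\to t_0$ as $r\to0^+$, and stays before the apparent horizon, $R_g(r)>R_h(r)$ for $0<r<r_0$. That is, the central singularity is locally naked. -/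

import Mathlib

open Set Filter Topology Asymptotics

noncomputable section

/-- Derivative of the energy density `ε` with respect to the matter density, for an equation of
state given on `[ρbar, ∞)` (one-sided at the endpoint). -/
def dEnergy (ε : ℝ → ℝ) (ρbar ρ : ℝ) : ℝ := derivWithin ε (Ici ρbar) ρ

/-- The isotropic pressure `p = ρ dε/dρ - ε`. -/
def pressure (ε : ℝ → ℝ) (ρbar ρ : ℝ) : ℝ := ρ * dEnergy ε ρbar ρ - ε ρ

/-- Admissible barotropic equations of state `ε` on `[ρbar, ∞)`: `ε` is `C¹`, nonnegative and
vanishes exactly at `ρbar`; the pressure is `C¹` and nonnegative, and it is strictly positive with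
`dp/dρ > 0` outside a bounded interval `[ρbar, ρ₁]`, on which it may vanish. -/
structure IsEquationOfState (ε : ℝ → ℝ) (ρbar : ℝ) : Prop where
  rhobar_nonneg : 0 ≤ ρbar
  energy_contDiff : ContDiffOn ℝ 1 ε (Ici ρbar)
  energy_nonneg : ∀ ρ ∈ Ici ρbar, 0 ≤ ε ρ
  energy_eq_zero_iff : ∀ ρ ∈ Ici ρbar, ε ρ = 0 ↔ ρ = ρbar
  pressure_contDiff : ContDiffOn ℝ 1 (pressure ε ρbar) (Ici ρbar)
  pressure_nonneg : ∀ ρ ∈ Ici ρbar, 0 ≤ pressure ε ρbar ρ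
  pressure_increasing : ∃ ρ₁, ρbar ≤ ρ₁ ∧
    (∀ ρ, ρ₁ < ρ →
      0 < pressure ε ρbar ρ ∧ 0 < derivWithin (pressure ε ρbar) (Ici ρbar) ρ) ∧
    (∀ ρ ∈ Ioc ρbar ρ₁, 0 < pressure ε ρbar ρ →
      0 < derivWithin (pressure ε ρbar) (Ici ρbar) ρ)

/-- The fields of a spherical barotropic fluid in area-radius coordinates `(r, R)`, on the region
`0 < R ≤ r < rmax`: `r` labels the shells and `R` is the area radius. -/
structure SphericalFluid where
  /-- energy density as a function of the matter density -/
  ε : ℝ → ℝ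
  /-- left endpoint of the domain of the equation of state -/
  ρbar : ℝ
  /-- range of the shell label -/
  rmax : ℝ
  /-- Misner-Sharp mass `Ψ(r, R)` -/
  Ψ : ℝ → ℝ → ℝ
  /-- matter density `ρ(r, R)` -/
  ρ : ℝ → ℝ → ℝ
  /-- the function of the shell label in `ρ = exp (-λ) / (4 π E R²)` -/
  E : ℝ → ℝ

namespace SphericalFluid

variable (F : SphericalFluid)

/-- The partial derivative `Ψ,r`. -/
def massr (r R : ℝ) : ℝ := deriv (fun s => F.Ψ s R) r

/-- The partial derivative `Ψ,R`. -/
def massR (r R : ℝ) : ℝ := deriv (fun S => F.Ψ r S) R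

/-- The energy density at `(r, R)`. -/
def energy (r R : ℝ) : ℝ := F.ε (F.ρ r R)

/-- The pressure at `(r, R)`. -/
def press (r R : ℝ) : ℝ := pressure F.ε F.ρbar (F.ρ r R)

/-- The value of `dε/dρ` at `(r, R)`. -/
def enthalpy (r R : ℝ) : ℝ := dEnergy F.ε F.ρbar (F.ρ r R)

/-- The derivative `R'` of the area radius along a shell-orthogonal slice (fixed comoving time),
`R' = Ψ,r / (4 π R² (ε + p))`. -/
def Rprime (r R : ℝ) : ℝ :=
  F.massr r R / (4 * Real.pi * R ^ 2 * (F.energy r R + F.press r R))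

/-- The function `Y = R' exp (-λ) = E Ψ,r / (dε/dρ)`. -/
def Y (r R : ℝ) : ℝ := F.E r * F.massr r R / F.enthalpy r R

/-- The square of the velocity, `u² = 2 Ψ / R + Y² - 1`. -/
def uSq (r R : ℝ) : ℝ := 2 * F.Ψ r R / R + F.Y r R ^ 2 - 1

/-- The velocity `u = |exp (-ν) ∂R/∂t|`. -/
def u (r R : ℝ) : ℝ := Real.sqrt (F.uSq r R)

/-- The lapse `exp ν`. The equation `p' = -(ε + p) ν'` integrates to `exp ν = (dε/dρ)⁻¹`, up to a
function of time which is absorbed in the comoving time. -/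
def lapse (r R : ℝ) : ℝ := (F.enthalpy r R)⁻¹

/-- The comoving time at which the shell `r`, starting from `R = r` at time zero, has area radius
`R`; it is obtained by integrating `∂R/∂t = -u exp ν`. -/
def comovingTime (r R : ℝ) : ℝ := ∫ σ in R..r, 1 / (F.lapse r σ * F.u r σ)

/-- The comoving time at which the shell `r` becomes singular, that is reaches `R = 0`. -/
def singularTime (r : ℝ) : ℝ := F.comovingTime r 0

/-- A collapsing spherical barotropic perfect fluid with regular initial data and analytic mass.
With `R'`, `Y`, `u` and `exp ν` as above, the equation `Ψ,R = -4 π p R²` is what is left of the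
Einstein equations for the mass; the second-order equation for `Ψ` which results from eliminating
the other fields is not imposed. -/
structure IsCollapse : Prop where
  eos : IsEquationOfState F.ε F.ρbar
  rmax_pos : 0 < F.rmax
  /-- the mass is analytic at the centre -/
  mass_analytic : AnalyticAt ℝ (fun x : ℝ × ℝ => F.Ψ x.1 x.2) (0, 0)
  /-- the mass has odd parity -/
  mass_odd : ∀ᶠ x : ℝ × ℝ in 𝓝 (0, 0), F.Ψ (-x.1) (-x.2) = -F.Ψ x.1 x.2
  E_continuous : ContinuousOn F.E (Ioo 0 F.rmax)
  E_pos : ∀ r ∈ Ioo 0 F.rmax, 0 < F.E r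
  density_mem : ∀ r ∈ Ioo 0 F.rmax, ∀ R ∈ Ioc 0 r, F.ρ r R ∈ Ici F.ρbar
  /-- the field equation `p = -Ψ,R / (4 π R²)` -/
  press_eq : ∀ r ∈ Ioo 0 F.rmax, ∀ R ∈ Ioc 0 r,
    F.press r R = -F.massR r R / (4 * Real.pi * R ^ 2)
  /-- the pressure is positive -/
  press_pos : ∀ r ∈ Ioo 0 F.rmax, ∀ R ∈ Ioc 0 r, 0 < F.press r R
  /-- dominant energy condition -/
  dominant_energy : ∀ r ∈ Ioo 0 F.rmax, ∀ R ∈ Ioc 0 r, F.press r R ≤ F.energy r R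
  /-- no shell crossing -/
  massr_pos : ∀ r ∈ Ioo 0 F.rmax, ∀ R ∈ Ioc 0 r, 0 < F.massr r R
  /-- the shells move: `u² > 0` after the initial time -/
  uSq_pos : ∀ r ∈ Ioo 0 F.rmax, ∀ R ∈ Ioo 0 r, 0 < F.uSq r R
  /-- the initial surface is `R = r`, so that `R' = 1` there -/
  Rprime_initial : ∀ r ∈ Ioo 0 F.rmax, F.Rprime r r = 1
  /-- regularity of the metric at the centre -/
  center_regular : ∀ x ∈ Ioc (0 : ℝ) 1, Tendsto (fun r => F.Y r (x * r)) (𝓝[>] 0) (𝓝 1)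
  /-- the density diverges when a shell reaches `R = 0` -/
  density_diverges : ∀ r ∈ Ioo 0 F.rmax, Tendsto (F.ρ r) (𝓝[>] 0) atTop

/-- The central singularity forms at the finite comoving time `t₀ > 0`: every shell becomes
singular in a finite time, and these times tend to `t₀` at the centre. -/
def CentralSingularityAt (t₀ : ℝ) : Prop :=
  0 < t₀ ∧
  (∀ r ∈ Ioo 0 F.rmax,
    IntervalIntegrable (fun σ => 1 / (F.lapse r σ * F.u r σ)) MeasureTheory.volume 0 r) ∧
  Tendsto F.singularTime (𝓝[>] 0) (𝓝 t₀)

/-- The mass has leading structure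
`Ψ = (h / 2) (r³ - p₀ / (ε₀ + p₀) R³) + (terms of higher order)`, where `ε₀ > 0` and `p₀ > 0` are
the initial energy density and pressure at the centre and `h > 0`. -/
def HasMassExpansion (h ε₀ p₀ : ℝ) : Prop :=
  0 < h ∧ 0 < ε₀ ∧ 0 < p₀ ∧
  Tendsto (fun r => F.energy r r) (𝓝[>] 0) (𝓝 ε₀) ∧
  Tendsto (fun r => F.press r r) (𝓝[>] 0) (𝓝 p₀) ∧
  (fun x : ℝ × ℝ => F.Ψ x.1 x.2 - h / 2 * (x.1 ^ 3 - p₀ / (ε₀ + p₀) * x.2 ^ 3))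
    =o[𝓝 (0, 0)] fun x : ℝ × ℝ => ‖x‖ ^ 3

/-- `Rh` is the apparent horizon on `(0, r₀)`: `Rh r` is the unique `R ∈ (0, r]` with
`R = 2 Ψ(r, R)`. -/
def IsApparentHorizon (r₀ : ℝ) (Rh : ℝ → ℝ) : Prop :=
  ∀ r ∈ Ioo 0 r₀, Rh r ∈ Ioc 0 r ∧ ∀ R ∈ Ioc 0 r, R = 2 * F.Ψ r R ↔ R = Rh r

/-- `Rg` solves, on `(0, r₀)`, the equation `dR/dr = R' (1 - u / Y)` of outgoing radial null
geodesics. -/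
def IsRadialNullGeodesic (r₀ : ℝ) (Rg : ℝ → ℝ) : Prop :=
  ∀ r ∈ Ioo 0 r₀, Rg r ∈ Ioo 0 r ∧
    HasDerivAt Rg (F.Rprime r (Rg r) * (1 - F.u r (Rg r) / F.Y r (Rg r))) r

/-- The curve `Rg` extends back to the central singularity that forms at the comoving time `t₀`:
it reaches `R = 0` at the centre, and the comoving time along it tends to `t₀`. -/
def ExtendsBackToSingularity (t₀ : ℝ) (Rg : ℝ → ℝ) : Prop :=
  Tendsto Rg (𝓝[>] 0) (𝓝 0) ∧
  Tendsto (fun r => F.comovingTime r (Rg r)) (𝓝[>] 0) (𝓝 t₀)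

/-- The central singularity at the comoving time `t₀` is locally naked: some radial null geodesic
extends back to it and stays before the apparent horizon, `Rg r > Rh r`. -/
def IsLocallyNaked (t₀ : ℝ) : Prop :=
  ∃ r₀ ∈ Ioc 0 F.rmax, ∃ Rh Rg : ℝ → ℝ,
    F.IsApparentHorizon r₀ Rh ∧ F.IsRadialNullGeodesic r₀ Rg ∧
    F.ExtendsBackToSingularity t₀ Rg ∧ ∀ r ∈ Ioo 0 r₀, Rh r < Rg r

end SphericalFluid

end

/-! For small `r` the apparent horizon is close to `R = h r³`, and the geodesic is trapped between
two cubics around it. On `R = (h/2) r³`, inside the horizon, the outgoing slope is nonpositive. On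
`R = y r³`, with `y > h`, it is at least of order `r⁻⁴`, far above the slope `3 y r²` of that curve.
A solution started between the two and followed towards `r = 0` can leave through neither
(`exists_solution_between`), so it tends to `0`. Along it `R - 2Ψ` can only decrease through a zero,
since the slope vanishes on the horizon and `Ψ,r > 0`; hence it stays outside the horizon.

The bound `r⁻⁴` (`eventually_lt_outgoingSlope`) has a factor `Ψ,r / R²` of order `r² / r⁶`; the
point is to bound the density on `R = y r³`. Because `u² > 0`, the density is bounded on `R = x r³`
for one large `x` (`exists_density_le`). Integrating `Ψ,RR = O(r³)` inwards gives `p R² = O(r⁶)` for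
all `R ≤ x r³` (`exists_press_le`), so `p` is bounded on `R = y r³`. Since `p` is unbounded as a
function of the density (`exists_lt_pressure`), the density is bounded there too. The estimate of
`Ψ,RR` needs the remainder `O(r⁵)` of the mass, which is where analyticity and odd parity enter.

The time from the geodesic to `R = 0` must also vanish at the centre. Dominant energy turns the
pressure bound into `R dε/dρ = O(r³)` (`exists_enthalpy_le`), while `u² R ≥ m r³` if `y` is close to
`h` (`exists_uSq_ge`). The remaining time is then `O(r³)` (`exists_integral_le`). -/

noncomputable section

/-! ### Monotonicity properties of the equation of state -/

namespace IsEquationOfState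

variable {ε : ℝ → ℝ} {ρbar : ℝ}

lemma hasDerivAt_energy (h : IsEquationOfState ε ρbar) {x : ℝ} (hx : ρbar < x) :
    HasDerivAt ε (dEnergy ε ρbar x) x :=
  ((h.energy_contDiff.differentiableOn one_ne_zero) x hx.le).hasDerivWithinAt.hasDerivAt
    (Ici_mem_nhds hx)

lemma hasDerivAt_pressure (h : IsEquationOfState ε ρbar) {x : ℝ} (hx : ρbar < x) :
    HasDerivAt (pressure ε ρbar) (derivWithin (pressure ε ρbar) (Ici ρbar) x) x :=
  ((h.pressure_contDiff.differentiableOn one_ne_zero) x hx.le).hasDerivWithinAt.hasDerivAt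
    (Ici_mem_nhds hx)

lemma contDiffAt_energy (h : IsEquationOfState ε ρbar) {x : ℝ} (hx : ρbar < x) :
    ContDiffAt ℝ 1 ε x :=
  h.energy_contDiff.contDiffAt (Ici_mem_nhds hx)

lemma contDiffAt_pressure (h : IsEquationOfState ε ρbar) {x : ℝ} (hx : ρbar < x) :
    ContDiffAt ℝ 1 (pressure ε ρbar) x :=
  h.pressure_contDiff.contDiffAt (Ici_mem_nhds hx)

lemma dEnergy_eq {x : ℝ} (hx : x ≠ 0) :
    dEnergy ε ρbar x = (pressure ε ρbar x + ε x) / x := by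
  unfold pressure; field_simp; ring

lemma pos_of_lt (h : IsEquationOfState ε ρbar) {x : ℝ} (hx : ρbar < x) : 0 < x :=
  h.rhobar_nonneg.trans_lt hx

lemma energy_pos (h : IsEquationOfState ε ρbar) {x : ℝ} (hx : ρbar < x) : 0 < ε x :=
  lt_of_le_of_ne (h.energy_nonneg x hx.le)
    fun he => hx.ne' ((h.energy_eq_zero_iff x hx.le).1 he.symm)

lemma derivWithin_pressure_pos (h : IsEquationOfState ε ρbar) {x : ℝ} (hx : ρbar < x)
    (hp : 0 < pressure ε ρbar x) : 0 < derivWithin (pressure ε ρbar) (Ici ρbar) x := by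
  obtain ⟨ρ₁, -, h1, h2⟩ := h.pressure_increasing
  rcases le_or_gt x ρ₁ with hle | hlt
  · exact h2 x ⟨hx, hle⟩ hp
  · exact (h1 x hlt).2

lemma dEnergy_pos (h : IsEquationOfState ε ρbar) {x : ℝ} (hx : ρbar < x) :
    0 < dEnergy ε ρbar x := by
  rw [dEnergy_eq (h.pos_of_lt hx).ne']
  have := h.energy_pos hx
  have := h.pressure_nonneg x hx.le
  have := h.pos_of_lt hx
  positivity

/-- On the lower range the sign of `dp/dρ` is known only where `p > 0`. This suffices: the pressure
could fall below `p(a) > 0` only by leaving the level `p(a)`, where its derivative is positive. -/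
lemma pressure_le_of_le (h : IsEquationOfState ε ρbar) {a b : ℝ} (ha : ρbar < a)
    (hp : 0 < pressure ε ρbar a) (hab : a ≤ b) : pressure ε ρbar a ≤ pressure ε ρbar b := by
  have hd : ∀ x ∈ Icc a b,
      HasDerivAt (fun y => -pressure ε ρbar y)
        (-derivWithin (pressure ε ρbar) (Ici ρbar) x) x :=
    fun x hx => (h.hasDerivAt_pressure (ha.trans_le hx.1)).neg
  have := image_le_of_deriv_right_lt_deriv_boundary
    (fun x hx => (hd x hx).continuousAt.continuousWithinAt)
    (fun x hx => (hd x ⟨hx.1, hx.2.le⟩).hasDerivWithinAt)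
    (B := fun _ => -pressure ε ρbar a) (B' := fun _ => 0) le_rfl
    (fun x => hasDerivAt_const x _) (fun x hx he => by
      have he' : pressure ε ρbar x = pressure ε ρbar a := by linarith
      have := h.derivWithin_pressure_pos (ha.trans_le hx.1) (he' ▸ hp)
      linarith) (right_mem_Icc.2 hab)
  linarith

lemma pressure_pos_of_le (h : IsEquationOfState ε ρbar) {a b : ℝ} (ha : ρbar < a)
    (hp : 0 < pressure ε ρbar a) (hab : a ≤ b) : 0 < pressure ε ρbar b :=
  hp.trans_le (h.pressure_le_of_le ha hp hab)

/-- Although `ε` is only `C¹`, `dε/dρ = (p + ε)/ρ` is differentiable because `p` is. -/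
lemma hasDerivAt_dEnergy (h : IsEquationOfState ε ρbar) {x : ℝ} (hx : ρbar < x) :
    HasDerivAt (dEnergy ε ρbar) (derivWithin (pressure ε ρbar) (Ici ρbar) x / x) x := by
  have hx0 := h.pos_of_lt hx
  have h1 := ((h.hasDerivAt_pressure hx).add (h.hasDerivAt_energy hx)).div
    (hasDerivAt_id x) hx0.ne'
  have h2 : dEnergy ε ρbar =ᶠ[𝓝 x] (pressure ε ρbar + ε) / id := by
    filter_upwards [Ioi_mem_nhds hx] with y hy
    simp [dEnergy_eq (ε := ε) (ρbar := ρbar) (h.pos_of_lt hy).ne']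
  refine (h1.congr_of_eventuallyEq h2).congr_deriv ?_
  simp only [Pi.add_apply, id, dEnergy_eq (ε := ε) (ρbar := ρbar) hx0.ne']
  field_simp
  ring

lemma pressure_strictMonoOn (h : IsEquationOfState ε ρbar) {a : ℝ} (ha : ρbar < a)
    (hp : 0 < pressure ε ρbar a) : StrictMonoOn (pressure ε ρbar) (Ici a) := by
  refine strictMonoOn_of_deriv_pos (convex_Ici a)
    (fun x hx => (h.hasDerivAt_pressure (ha.trans_le hx)).continuousAt.continuousWithinAt)
    fun x hx => ?_
  have hx' : a ≤ x := interior_subset hx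
  rw [(h.hasDerivAt_pressure (ha.trans_le hx')).deriv]
  exact h.derivWithin_pressure_pos (ha.trans_le hx') (h.pressure_pos_of_le ha hp hx')

lemma dEnergy_strictMonoOn (h : IsEquationOfState ε ρbar) {a : ℝ} (ha : ρbar < a)
    (hp : 0 < pressure ε ρbar a) : StrictMonoOn (dEnergy ε ρbar) (Ici a) := by
  refine strictMonoOn_of_deriv_pos (convex_Ici a)
    (fun x hx => (h.hasDerivAt_dEnergy (ha.trans_le hx)).continuousAt.continuousWithinAt)
    fun x hx => ?_
  have hx' : a ≤ x := interior_subset hx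
  rw [(h.hasDerivAt_dEnergy (ha.trans_le hx')).deriv]
  exact div_pos (h.derivWithin_pressure_pos (ha.trans_le hx') (h.pressure_pos_of_le ha hp hx'))
    (h.pos_of_lt (ha.trans_le hx'))

lemma lt_of_pressure_lt (h : IsEquationOfState ε ρbar) {a b : ℝ} (hb : ρbar < b)
    (hpb : 0 < pressure ε ρbar b) (hab : pressure ε ρbar a < pressure ε ρbar b) : a < b := by
  by_contra! hle
  exact absurd (h.pressure_le_of_le hb hpb hle) (not_le.2 hab)

lemma eq_of_pressure_eq (h : IsEquationOfState ε ρbar) {a b : ℝ} (ha : ρbar < a) (hb : ρbar < b)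
    (hpa : 0 < pressure ε ρbar a) (hab : pressure ε ρbar a = pressure ε ρbar b) : a = b := by
  rcases le_total a b with hle | hle
  · exact (h.pressure_strictMonoOn ha hpa).injOn self_mem_Ici hle hab
  · exact ((h.pressure_strictMonoOn hb (hab ▸ hpa)).injOn self_mem_Ici hle hab.symm).symm

lemma le_of_dEnergy_le (h : IsEquationOfState ε ρbar) {a b : ℝ} (hb : ρbar < b)
    (hpb : 0 < pressure ε ρbar b) (hab : dEnergy ε ρbar a ≤ dEnergy ε ρbar b) : a ≤ b := by
  by_contra! hlt
  exact absurd (h.dEnergy_strictMonoOn hb hpb self_mem_Ici hlt.le hlt) (not_lt.2 hab)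

lemma dEnergy_mono (h : IsEquationOfState ε ρbar) {a b : ℝ} (ha : ρbar < a)
    (hpa : 0 < pressure ε ρbar a) (hab : a ≤ b) : dEnergy ε ρbar a ≤ dEnergy ε ρbar b :=
  (h.dEnergy_strictMonoOn ha hpa).monotoneOn self_mem_Ici hab hab

/-- The derivative of `ε/ρ` is `p/ρ² ≥ 0`. This turns bounds on the energy into bounds on the
density. -/
lemma energy_div_le (h : IsEquationOfState ε ρbar) {a b : ℝ} (ha : ρbar < a) (hab : a ≤ b) :
    ε a / a ≤ ε b / b := by
  have hd : ∀ x ∈ Icc a b, HasDerivAt (fun y => ε y / y) (pressure ε ρbar x / x ^ 2) x := by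
    intro x hx
    have hx' := ha.trans_le hx.1
    refine ((h.hasDerivAt_energy hx').div (hasDerivAt_id x) (h.pos_of_lt hx').ne').congr_deriv ?_
    simp only [pressure, id]; ring
  refine monotoneOn_of_deriv_nonneg (convex_Icc a b)
    (fun x hx => (hd x hx).continuousAt.continuousWithinAt)
    (fun x hx => (hd x (interior_subset hx)).differentiableAt.differentiableWithinAt)
    (fun x hx => ?_) (left_mem_Icc.2 hab) (right_mem_Icc.2 hab) hab
  rw [(hd x (interior_subset hx)).deriv]
  exact div_nonneg (h.pressure_nonneg x (ha.le.trans (interior_subset hx).1)) (sq_nonneg x)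

/-- Under the dominant energy condition `ε / ρ²` decreases. -/
lemma energy_div_sq_le (h : IsEquationOfState ε ρbar) {a b : ℝ} (ha : ρbar < a) (hab : a ≤ b)
    (hdom : ∀ x ∈ Icc a b, pressure ε ρbar x ≤ ε x) : ε b / b ^ 2 ≤ ε a / a ^ 2 := by
  have hd : ∀ x ∈ Icc a b,
      HasDerivAt (fun y => ε y / y ^ 2) ((pressure ε ρbar x - ε x) / x ^ 3) x := by
    intro x hx
    have hx' := ha.trans_le hx.1
    have hx0 := (h.pos_of_lt hx').ne'
    refine ((h.hasDerivAt_energy hx').div (hasDerivAt_pow 2 x) (pow_ne_zero 2 hx0)).congr_deriv ?_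
    simp only [pressure]; field_simp; push_cast; ring
  refine antitoneOn_of_deriv_nonpos (convex_Icc a b)
    (fun x hx => (hd x hx).continuousAt.continuousWithinAt)
    (fun x hx => (hd x (interior_subset hx)).differentiableAt.differentiableWithinAt)
    (fun x hx => ?_) (left_mem_Icc.2 hab) (right_mem_Icc.2 hab) hab
  have hx := interior_subset hx
  rw [(hd x hx).deriv]
  exact div_nonpos_of_nonpos_of_nonneg (sub_nonpos.2 (hdom x hx))
    (pow_nonneg (h.pos_of_lt (ha.trans_le hx.1)).le 3)

/-- Under the dominant energy condition `(dε/dρ)² / p` decreases. -/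
lemma dEnergy_sq_div_pressure_le (h : IsEquationOfState ε ρbar) {a b : ℝ} (ha : ρbar < a)
    (hpa : 0 < pressure ε ρbar a) (hab : a ≤ b)
    (hdom : ∀ x ∈ Icc a b, pressure ε ρbar x ≤ ε x) :
    dEnergy ε ρbar b ^ 2 / pressure ε ρbar b ≤ dEnergy ε ρbar a ^ 2 / pressure ε ρbar a := by
  set q := derivWithin (pressure ε ρbar) (Ici ρbar) with hq
  have hd : ∀ x ∈ Icc a b, HasDerivAt (fun y => dEnergy ε ρbar y ^ 2 / pressure ε ρbar y)
      (q x * dEnergy ε ρbar x * (pressure ε ρbar x - ε x) / (x * pressure ε ρbar x ^ 2)) x := by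
    intro x hx
    have hx' := ha.trans_le hx.1
    have hx0 := (h.pos_of_lt hx').ne'
    have hp0 := (h.pressure_pos_of_le ha hpa hx.1).ne'
    refine (((h.hasDerivAt_dEnergy hx').pow 2).div (h.hasDerivAt_pressure hx') hp0).congr_deriv ?_
    have he : ε x = x * dEnergy ε ρbar x - pressure ε ρbar x := by simp [pressure]
    rw [he]; simp only [← hq, Pi.pow_apply]; field_simp; push_cast; ring
  refine antitoneOn_of_deriv_nonpos (convex_Icc a b)
    (fun x hx => (hd x hx).continuousAt.continuousWithinAt)
    (fun x hx => (hd x (interior_subset hx)).differentiableAt.differentiableWithinAt)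
    (fun x hx => ?_) (left_mem_Icc.2 hab) (right_mem_Icc.2 hab) hab
  have hx := interior_subset hx
  rw [(hd x hx).deriv]
  have hx' := ha.trans_le hx.1
  refine div_nonpos_of_nonpos_of_nonneg (mul_nonpos_of_nonneg_of_nonpos (mul_nonneg
    (h.derivWithin_pressure_pos hx' (h.pressure_pos_of_le ha hpa hx.1)).le
    (h.dEnergy_pos hx').le) (sub_nonpos.2 (hdom x hx))) ?_
  exact mul_nonneg (h.pos_of_lt hx').le (sq_nonneg _)

end IsEquationOfState

/-! ### Orders of vanishing of analytic functions -/

namespace FormalMultilinearSeries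

variable {E F : Type*} [NormedAddCommGroup E] [NormedSpace ℝ E] [NormedAddCommGroup F]
  [NormedSpace ℝ F]

/-- The power series with its terms of degree less than `n` removed. -/
def dropTerms (p : FormalMultilinearSeries ℝ E F) (n : ℕ) : FormalMultilinearSeries ℝ E F :=
  fun k => if k < n then 0 else p k

lemma radius_le_radius_dropTerms (p : FormalMultilinearSeries ℝ E F) (n : ℕ) :
    p.radius ≤ (p.dropTerms n).radius := by
  refine radius_le_of_le fun k => ?_
  unfold dropTerms
  split_ifs <;> simp

end FormalMultilinearSeries

section

variable {E F : Type*} [NormedAddCommGroup E] [NormedSpace ℝ E] [NormedAddCommGroup F]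
  [NormedSpace ℝ F]

/-- By induction the term of degree `k` is `o(‖x‖ᵏ)`; being homogeneous of degree `k`, it vanishes,
as scaling `x` by `t → 0⁺` shows. -/
lemma HasFPowerSeriesAt.apply_diag_eq_zero {f : E → F} {p : FormalMultilinearSeries ℝ E F}
    (hf : HasFPowerSeriesAt f p 0) {n : ℕ} (hfo : f =o[𝓝 0] fun x => ‖x‖ ^ n) :
    ∀ k ≤ n, ∀ x : E, p k (fun _ => x) = 0 := by
  intro k
  induction k using Nat.strong_induction_on with
  | _ k ih =>
  intro hk x
  have h1 : (fun y => f y - p k fun _ => y) =O[𝓝 0] fun y => ‖y‖ ^ (k + 1) := by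
    have := hf.isBigO_sub_partialSum_pow (k + 1)
    refine this.congr_left fun y => ?_
    rw [zero_add, FormalMultilinearSeries.partialSum, Finset.sum_range_succ,
      Finset.sum_eq_zero fun j hj => ?_, zero_add]
    exact ih j (Finset.mem_range.1 hj) ((Finset.mem_range.1 hj).le.trans hk) y
  have h2 : (fun y : E => ‖y‖ ^ (k + 1)) =o[𝓝 0] fun y => ‖y‖ ^ k := by
    have : (fun y : ℝ => y ^ (k + 1)) =o[𝓝 0] fun y => y ^ k := isLittleO_pow_pow k.lt_succ_self
    exact this.comp_tendsto (tendsto_norm_zero)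
  have h3 : (fun y : E => ‖y‖ ^ n) =O[𝓝 0] fun y => ‖y‖ ^ k := by
    have : (fun y : ℝ => y ^ n) =O[𝓝 0] fun y => y ^ k := by
      rcases hk.eq_or_lt with rfl | hlt
      · exact isBigO_refl _ _
      · exact (isLittleO_pow_pow hlt).isBigO
    exact this.comp_tendsto (tendsto_norm_zero)
  have h4 : (fun y => p k fun _ => y) =o[𝓝 0] fun y => ‖y‖ ^ k := by
    refine ((hfo.trans_isBigO h3).sub (h1.trans_isLittleO h2)).congr_left fun y => ?_
    abel
  have h5 : Tendsto (fun t : ℝ => t • x) (𝓝[>] 0) (𝓝 0) := by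
    have : Tendsto (fun t : ℝ => t • x) (𝓝 0) (𝓝 ((0 : ℝ) • x)) :=
      (continuous_id.smul continuous_const).tendsto 0
    rw [zero_smul] at this
    exact this.mono_left nhdsWithin_le_nhds
  have h6 := h4.comp_tendsto h5
  have h7 : (fun _ : ℝ => p k fun _ => x) =o[𝓝[>] 0] fun _ : ℝ => ‖x‖ ^ k := by
    rw [isLittleO_iff] at h6 ⊢
    intro c hc
    filter_upwards [h6 hc, self_mem_nhdsWithin] with t ht ht0
    have ht0 : 0 < t := ht0
    simp only [Function.comp] at ht
    have : (p k fun _ => t • x) = t ^ k • p k fun _ => x := by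
      rw [ContinuousMultilinearMap.map_smul_univ (p k) (fun _ => t) fun _ => x]; simp
    rw [this, norm_smul, norm_smul, norm_pow, mul_pow, norm_mul, norm_pow, norm_pow, norm_norm,
      norm_norm] at ht
    rw [norm_pow, norm_norm]
    have hp : 0 < ‖t‖ ^ k := pow_pos (norm_pos_iff.2 ht0.ne') k
    exact le_of_mul_le_mul_left (by linarith) hp
  exact isLittleO_const_const_iff.1 h7

/-- An analytic odd function which vanishes to an odd order vanishes to the next odd order. -/
lemma AnalyticAt.isBigO_of_odd {f : E → F} (hf : AnalyticAt ℝ f 0) {n : ℕ} (hn : Odd n)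
    (hodd : ∀ᶠ x in 𝓝 0, f (-x) = -f x)
    (hfo : f =o[𝓝 0] fun x => ‖x‖ ^ n) : f =O[𝓝 0] fun x => ‖x‖ ^ (n + 2) := by
  obtain ⟨p, hp⟩ := hf
  have h1 : (fun y => f y - p (n + 1) fun _ => y) =O[𝓝 0] fun y => ‖y‖ ^ (n + 2) := by
    refine (hp.isBigO_sub_partialSum_pow (n + 2)).congr_left fun y => ?_
    rw [zero_add, FormalMultilinearSeries.partialSum, Finset.sum_range_succ,
      Finset.sum_eq_zero fun j hj => ?_, zero_add]
    exact hp.apply_diag_eq_zero hfo j (Nat.lt_succ_iff.1 (Finset.mem_range.1 hj)) y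
  -- As `n + 1` is even, the term of this degree is invariant under `y ↦ -y` and cancels in `f y - f
  -- (-y) = 2 f y`.
  have h2 := h1.comp_tendsto (by simpa using (continuous_neg (G := E)).tendsto 0)
  have h2' : (fun y => f (-y) - p (n + 1) fun _ => y) =O[𝓝 0] fun y => ‖y‖ ^ (n + 2) := by
    refine h2.congr (fun y => ?_) fun y => by simp
    have : (p (n + 1) fun _ => -y) = p (n + 1) fun _ => y := by
      have := ContinuousMultilinearMap.map_smul_univ (p (n + 1)) (fun _ => (-1 : ℝ)) fun _ => y
      simpa [hn.add_one.neg_one_pow] using this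
    simp [this]
  refine (((h1.sub h2').const_smul_left (2⁻¹ : ℝ))).congr' ?_ EventuallyEq.rfl
  filter_upwards [hodd] with y hy
  simp only [Pi.smul_apply, hy]
  rw [show f y - (p (n + 1) fun _ => y) - (-f y - p (n + 1) fun _ => y) = (2 : ℝ) • f y by
    rw [two_smul]; abel, smul_smul]
  norm_num

/-- The low terms of the series vanish only on the diagonal, not necessarily as multilinear maps.
Dropping them leaves the sum unchanged and makes the low terms of the derived series literally zero.
-/
lemma AnalyticAt.isBigO_fderiv [CompleteSpace F] {f : E → F} (hf : AnalyticAt ℝ f 0) {n : ℕ}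
    (hfo : f =O[𝓝 0] fun x => ‖x‖ ^ (n + 1)) : fderiv ℝ f =O[𝓝 0] fun x => ‖x‖ ^ n := by
  have hfo' : f =o[𝓝 0] fun x => ‖x‖ ^ n := by
    refine hfo.trans_isLittleO ?_
    have : (fun y : ℝ => y ^ (n + 1)) =o[𝓝 0] fun y => y ^ n := isLittleO_pow_pow n.lt_succ_self
    exact this.comp_tendsto (tendsto_norm_zero)
  obtain ⟨p, r, hp⟩ := hf
  have hz := HasFPowerSeriesAt.apply_diag_eq_zero ⟨r, hp⟩ hfo'
  have hq : HasFPowerSeriesOnBall f (p.dropTerms (n + 1)) 0 r := by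
    refine ⟨hp.r_le.trans (p.radius_le_radius_dropTerms _), hp.r_pos, fun {y} hy => ?_⟩
    convert hp.hasSum hy using 2 with k
    unfold FormalMultilinearSeries.dropTerms
    split_ifs with hk
    · simp [hz k (Nat.lt_succ_iff.1 hk) y]
    · rfl
  refine (hq.fderiv.hasFPowerSeriesAt.isBigO_sub_partialSum_pow n).congr_left fun y => ?_
  rw [zero_add, FormalMultilinearSeries.partialSum, Finset.sum_eq_zero fun j hj => ?_, sub_zero]
  rw [FormalMultilinearSeries.derivSeries_eq_zero]
  · simp
  · have := Finset.mem_range.1 hj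
    simp [FormalMultilinearSeries.dropTerms, this]

end

section

variable {f : ℝ × ℝ → ℝ}

lemma AnalyticAt.fderiv_apply {x : ℝ × ℝ} (hf : AnalyticAt ℝ f x) (v : ℝ × ℝ) :
    AnalyticAt ℝ (fun y => fderiv ℝ f y v) x :=
  ((ContinuousLinearMap.apply ℝ ℝ v).analyticAt _).comp hf.fderiv

lemma AnalyticAt.isBigO_fderiv_apply (hf : AnalyticAt ℝ f 0) {n : ℕ}
    (hfo : f =O[𝓝 0] fun x => ‖x‖ ^ (n + 1)) (v : ℝ × ℝ) :
    (fun y => fderiv ℝ f y v) =O[𝓝 0] fun x => ‖x‖ ^ n :=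
  ((ContinuousLinearMap.apply ℝ ℝ v).isBigO_comp (fderiv ℝ f) (𝓝 0)).trans (hf.isBigO_fderiv hfo)

lemma AnalyticAt.hasDerivAt_fst {r R : ℝ} (hf : AnalyticAt ℝ f (r, R)) :
    HasDerivAt (fun s => f (s, R)) (fderiv ℝ f (r, R) (1, 0)) r :=
  hf.differentiableAt.hasFDerivAt.comp_hasDerivAt (f := fun s : ℝ => (s, R)) r
    ((hasDerivAt_id r).prodMk (hasDerivAt_const r R))

lemma AnalyticAt.hasDerivAt_snd {r R : ℝ} (hf : AnalyticAt ℝ f (r, R)) :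
    HasDerivAt (fun s => f (r, s)) (fderiv ℝ f (r, R) (0, 1)) R :=
  hf.differentiableAt.hasFDerivAt.comp_hasDerivAt (f := fun s : ℝ => (r, s)) R
    ((hasDerivAt_const R r).prodMk (hasDerivAt_id R))

lemma Asymptotics.IsBigO.exists_abs_le {n : ℕ} (hf : f =O[𝓝 0] fun x => ‖x‖ ^ n) :
    ∃ C, ∀ᶠ x in 𝓝 0, |f x| ≤ C * ‖x‖ ^ n := by
  obtain ⟨C, hC⟩ := hf.bound
  exact ⟨C, by simpa using hC⟩

end

/-- Estimates for an analytic odd function of two variables with cubic leading part, and for its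
derivatives. -/
theorem exists_cubic_estimates {Ψ : ℝ → ℝ → ℝ} {h α : ℝ}
    (han : AnalyticAt ℝ (fun x : ℝ × ℝ => Ψ x.1 x.2) (0, 0))
    (hodd : ∀ᶠ x : ℝ × ℝ in 𝓝 (0, 0), Ψ (-x.1) (-x.2) = -Ψ x.1 x.2)
    (hexp : (fun x : ℝ × ℝ => Ψ x.1 x.2 - h / 2 * (x.1 ^ 3 - α * x.2 ^ 3))
      =o[𝓝 (0, 0)] fun x : ℝ × ℝ => ‖x‖ ^ 3) :
    ∃ C > 0, ∃ δ > 0, ∃ D₂ D₃ : ℝ → ℝ → ℝ, ∀ r R, |r| < δ → |R| ≤ |r| →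
      AnalyticAt ℝ (fun x : ℝ × ℝ => Ψ x.1 x.2) (r, R) ∧
      |Ψ r R - h / 2 * (r ^ 3 - α * R ^ 3)| ≤ C * |r| ^ 5 ∧
      |deriv (fun s => Ψ s R) r - 3 * h / 2 * r ^ 2| ≤ C * |r| ^ 4 ∧
      |deriv (fun S => Ψ r S) R + 3 * h * α / 2 * R ^ 2| ≤ C * |r| ^ 4 ∧
      HasDerivAt (fun S => deriv (fun S => Ψ r S) S) (D₂ r R) R ∧
      |D₂ r R + 3 * h * α * R| ≤ C * |r| ^ 3 ∧
      HasDerivAt (fun S => D₂ r S) (D₃ r R) R ∧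
      |D₃ r R + 3 * h * α| ≤ C * |r| ^ 2 := by
  set f : ℝ × ℝ → ℝ := fun x => Ψ x.1 x.2 - h / 2 * (x.1 ^ 3 - α * x.2 ^ 3) with hf
  have hpoly : ∀ x : ℝ × ℝ,
      AnalyticAt ℝ (fun x : ℝ × ℝ => h / 2 * (x.1 ^ 3 - α * x.2 ^ 3)) x := fun x =>
    analyticAt_const.mul ((analyticAt_fst.pow 3).sub (analyticAt_const.mul (analyticAt_snd.pow 3)))
  have hfa : AnalyticAt ℝ f 0 := han.sub (hpoly _)
  have hfodd : ∀ᶠ x in 𝓝 (0 : ℝ × ℝ), f (-x) = -f x := by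
    filter_upwards [hodd] with x hx
    simp only [hf, Prod.fst_neg, Prod.snd_neg, hx]; ring
  -- Parity improves the remainder from `o(‖x‖³)` to `O(‖x‖⁵)`; each derivative then costs one
  -- order.
  have h0 : f =O[𝓝 0] fun x => ‖x‖ ^ 5 := hfa.isBigO_of_odd (by decide) hfodd hexp
  set f₁ : ℝ × ℝ → ℝ := fun x => fderiv ℝ f x (0, 1) with hf₁
  set f₂ : ℝ × ℝ → ℝ := fun x => fderiv ℝ f₁ x (0, 1) with hf₂
  have a1 : AnalyticAt ℝ f₁ 0 := hfa.fderiv_apply _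
  have a2 : AnalyticAt ℝ f₂ 0 := a1.fderiv_apply _
  have h1 := hfa.isBigO_fderiv_apply h0 (0, 1)
  have h2 := a1.isBigO_fderiv_apply h1 (0, 1)
  have h3 := a2.isBigO_fderiv_apply h2 (0, 1)
  obtain ⟨C0, e0⟩ := h0.exists_abs_le
  obtain ⟨C1, e1⟩ := h1.exists_abs_le
  obtain ⟨C1', e1'⟩ := (hfa.isBigO_fderiv_apply h0 (1, 0)).exists_abs_le
  obtain ⟨C2, e2⟩ := h2.exists_abs_le
  obtain ⟨C3, e3⟩ := h3.exists_abs_le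
  have hall := e0.and <| e1.and <| e1'.and <| e2.and <| e3.and <|
    hfa.eventually_analyticAt.and <| a1.eventually_analyticAt.and <| a2.eventually_analyticAt
  obtain ⟨δ, hδ, hball⟩ := Metric.eventually_nhds_iff.1 hall
  refine ⟨max (max (max C0 C1) (max C1' C2)) (max C3 1), by positivity, δ, hδ,
    fun r R => f₂ (r, R) - 3 * h * α * R, fun r R => fderiv ℝ f₂ (r, R) (0, 1) - 3 * h * α,
    fun r R hr hR => ?_⟩
  set C := max (max (max C0 C1) (max C1' C2)) (max C3 1) with hC
  have hC0 : C0 ≤ C := by simp [hC]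
  have hC1 : C1 ≤ C := by simp [hC]
  have hC1' : C1' ≤ C := by simp [hC]
  have hC2 : C2 ≤ C := by simp [hC]
  have hC3 : C3 ≤ C := by simp [hC]
  have hnorm : ‖((r, R) : ℝ × ℝ)‖ = |r| := by simp [Prod.norm_def, hR]
  have hmem : ∀ S, |S| < δ → dist ((r, S) : ℝ × ℝ) 0 < δ := fun S hS => by
    rw [dist_zero_right, Prod.norm_def]; exact max_lt hr hS
  have hRδ := hR.trans_lt hr
  obtain ⟨b0, b1, b1', b2, b3, an, an1, an2⟩ := hball (hmem R hRδ)
  rw [hnorm] at b0 b1 b1' b2 b3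
  have up : ∀ {C' x : ℝ} {n : ℕ}, x ≤ C' * |r| ^ n → C' ≤ C → x ≤ C * |r| ^ n :=
    fun hx hc => hx.trans (mul_le_mul_of_nonneg_right hc (by positivity))
  have hΨ : (fun x : ℝ × ℝ => Ψ x.1 x.2) =
      fun x => f x + h / 2 * (x.1 ^ 3 - α * x.2 ^ 3) := by
    funext x; simp [hf]
  have hr' : HasDerivAt (fun s => Ψ s R)
      (fderiv ℝ f (r, R) (1, 0) + 3 * h / 2 * r ^ 2) r := by
    have := an.hasDerivAt_fst.add
      ((((hasDerivAt_pow 3 r).sub_const (α * R ^ 3))).const_mul (h / 2))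
    refine (this.congr_of_eventuallyEq (Eventually.of_forall fun s => ?_)).congr_deriv ?_
    · simp [hf]
    · push_cast; ring
  have hR' : ∀ S, |S| < δ → deriv (fun S => Ψ r S) S = f₁ (r, S) - 3 * h * α / 2 * S ^ 2 := by
    intro S hS
    obtain ⟨-, -, -, -, -, an, -⟩ := hball (hmem S hS)
    have := an.hasDerivAt_snd.add
      ((((hasDerivAt_pow 3 S).const_mul α).const_sub (r ^ 3)).const_mul (h / 2))
    refine HasDerivAt.deriv
      ((this.congr_of_eventuallyEq (Eventually.of_forall fun s => ?_)).congr_deriv ?_)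
    · simp [hf]
    · simp only [hf₁]; push_cast; ring
  refine ⟨?_, up b0 hC0, ?_, ?_, ?_, ?_, ?_, ?_⟩
  · rw [hΨ]; exact an.add (hpoly _)
  · rw [hr'.deriv, add_sub_cancel_right]; exact up b1' hC1'
  · rw [hR' R hRδ, sub_add_cancel]; exact up b1 hC1
  · have := an1.hasDerivAt_snd.sub ((hasDerivAt_pow 2 R).const_mul (3 * h * α / 2))
    refine (this.congr_of_eventuallyEq ?_).congr_deriv ?_
    · filter_upwards [(isOpen_lt continuous_abs continuous_const).mem_nhds hRδ] with S hS
      exact hR' S hS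
    · simp only [hf₂]; push_cast; ring
  · rw [sub_add_cancel]; exact up b2 hC2
  · have := an2.hasDerivAt_snd.sub ((hasDerivAt_id R).const_mul (3 * h * α))
    exact this.congr_deriv (by ring)
  · rw [sub_add_cancel]; exact up b3 hC3

/-! ### Barriers and differential equations on `(0, b]` -/

/-- A function which decreases through each of its zeros, and is positive at the right end of an
interval, is positive on the interval. -/
lemma pos_of_deriv_neg_of_eq_zero {D D' : ℝ → ℝ} {b : ℝ} (hc : ContinuousOn D (Ioc 0 b))
    (hb : 0 < D b) (hd : ∀ r ∈ Ioo 0 b, D r = 0 → D' r < 0)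
    (hD : ∀ r ∈ Ioo 0 b, HasDerivAt D (D' r) r) : ∀ r ∈ Ioc 0 b, 0 < D r := by
  intro a ha
  by_contra! hle
  have := image_le_of_deriv_right_lt_deriv_boundary (f := D) (f' := D') (a := a) (b := b)
    (hc.mono fun x hx => ⟨ha.1.trans_le hx.1, hx.2⟩)
    (fun x hx => (hD x ⟨ha.1.trans_le hx.1, hx.2⟩).hasDerivWithinAt)
    (B := fun _ => 0) (B' := fun _ => 0) hle (fun x => hasDerivAt_const x _)
    (fun x hx he => hd x ⟨ha.1.trans_le hx.1, hx.2⟩ he) (right_mem_Icc.2 ha.2)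
  linarith

/-- The bound `L` holds for all `x`, so Picard–Lindelöf on a ball of radius `L (b - a)` reaches the
whole interval from its right end. -/
lemma exists_solution_Icc {g : ℝ → ℝ → ℝ} {a b : ℝ} (hab : a ≤ b) {K L : NNReal}
    (hK : ∀ t ∈ Icc a b, LipschitzWith K (g t))
    (hc : ∀ x, ContinuousOn (fun t => g t x) (Icc a b))
    (hL : ∀ t ∈ Icc a b, ∀ x, ‖g t x‖ ≤ L) (x₀ : ℝ) :
    ∃ φ : ℝ → ℝ, φ b = x₀ ∧ ∀ t ∈ Icc a b, HasDerivWithinAt φ (g t (φ t)) (Icc a b) t := by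
  have hba : 0 ≤ b - a := sub_nonneg.2 hab
  have : IsPicardLindelof g (⟨b, right_mem_Icc.2 hab⟩ : Icc a b) x₀ (L * (b - a).toNNReal) 0 L K :=
    { lipschitzOnWith := fun t ht => (hK t ht).lipschitzOnWith
      continuousOn := fun x _ => hc x
      norm_le := fun t ht x _ => hL t ht x
      mul_max_le := by simp [hba] }
  exact this.exists_eq_forall_mem_Icc_hasDerivWithinAt₀

/-- A vector field on `(0, b]` which is bounded and Lipschitz on each `[a, b]` has solutions on
`(0, b]` with arbitrary value at `b`. -/
theorem exists_solution_Ioc {g : ℝ → ℝ → ℝ} {b : ℝ} (hb : 0 < b)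
    (hK : ∀ a ∈ Ioo 0 b, ∃ K : NNReal, ∀ t ∈ Icc a b, LipschitzWith K (g t))
    (hc : ∀ x, ContinuousOn (fun t => g t x) (Ioc 0 b))
    (hL : ∀ a ∈ Ioo 0 b, ∃ L : NNReal, ∀ t ∈ Icc a b, ∀ x, ‖g t x‖ ≤ L) (x₀ : ℝ) :
    ∃ φ : ℝ → ℝ, φ b = x₀ ∧ ContinuousOn φ (Ioc 0 b) ∧
      ∀ t ∈ Ioo 0 b, HasDerivAt φ (g t (φ t)) t := by
  have hex : ∀ a : Ioo 0 b, ∃ φ : ℝ → ℝ, φ b = x₀ ∧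
      ∀ t ∈ Icc (a : ℝ) b, HasDerivWithinAt φ (g t (φ t)) (Icc (a : ℝ) b) t := fun a => by
    obtain ⟨K, hK⟩ := hK a a.2
    obtain ⟨L, hL⟩ := hL a a.2
    exact exists_solution_Icc a.2.2.le hK
      (fun x => (hc x).mono fun t ht => ⟨a.2.1.trans_le ht.1, ht.2⟩) hL x₀
  choose φ hφb hφ using hex
  -- Uniqueness to the left of `b` makes the solutions on the intervals `[a, b]` compatible.
  have huniq : ∀ a a' : Ioo 0 b, (a : ℝ) ≤ a' → EqOn (φ a) (φ a') (Icc a' b) := by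
    intro a a' haa
    obtain ⟨K, hK⟩ := hK a' a'.2
    have key : ∀ c : Ioo 0 b, (c : ℝ) ≤ a' → ContinuousOn (φ c) (Icc a' b) ∧
        ∀ t ∈ Ioc (a' : ℝ) b, HasDerivWithinAt (φ c) (g t (φ c t)) (Iic t) t := by
      intro c hc
      refine ⟨fun t ht => ((hφ c t ⟨hc.trans ht.1, ht.2⟩).continuousWithinAt).mono
        (Icc_subset_Icc_left hc), fun t ht => ?_⟩
      refine (hφ c t ⟨hc.trans ht.1.le, ht.2⟩).mono_of_mem_nhdsWithin ?_
      exact mem_of_superset (Ioc_mem_nhdsLE (hc.trans_lt ht.1))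
        fun s hs => ⟨hs.1.le, hs.2.trans ht.2⟩
    exact ODE_solution_unique_of_mem_Icc_left (s := fun _ => univ)
      (fun t ht => (hK t (Ioc_subset_Icc_self ht)).lipschitzOnWith) (key a haa).1 (key a haa).2
      (fun _ _ => mem_univ _) (key a' le_rfl).1 (key a' le_rfl).2
      (fun _ _ => mem_univ _) ((hφb a).trans (hφb a').symm)
  have half : ∀ t ∈ Ioc 0 b, t / 2 ∈ Ioo 0 b := fun t ht =>
    ⟨half_pos ht.1, (half_lt_self ht.1).trans_le ht.2⟩
  -- At `t` the solution on `[t/2, b]` is used, so that `t` is never the left endpoint.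
  set ψ : ℝ → ℝ := fun t => if ht : t ∈ Ioc 0 b then φ ⟨t / 2, half t ht⟩ t else 0 with hψ
  have hψeq : ∀ a : Ioo 0 b, EqOn ψ (φ a) (Ioc a b) := by
    intro a t ht
    have ht' : t ∈ Ioc 0 b := ⟨a.2.1.trans ht.1, ht.2⟩
    simp only [hψ, dif_pos ht']
    rcases le_total (a : ℝ) (t / 2) with hle | hle
    · exact (huniq a ⟨t / 2, half t ht'⟩ hle ⟨(half_le_self ht'.1.le), ht.2⟩).symm
    · exact huniq ⟨t / 2, half t ht'⟩ a hle ⟨ht.1.le, ht.2⟩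
  refine ⟨ψ, ?_, ?_, ?_⟩
  · have hb' : b ∈ Ioc 0 b := right_mem_Ioc.2 hb
    rw [hψeq ⟨b / 2, half b hb'⟩ ⟨half_lt_self hb, le_rfl⟩, hφb]
  · intro t ht
    set a : Ioo 0 b := ⟨t / 2, half t ht⟩
    have hta : (a : ℝ) < t := half_lt_self ht.1
    have h1 := (hφ a t ⟨hta.le, ht.2⟩).continuousWithinAt
    refine ((h1.mono Ioc_subset_Icc_self).congr (hψeq a) (hψeq a ⟨hta, ht.2⟩)).mono_of_mem_nhdsWithin
      ?_
    rw [mem_nhdsWithin]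
    exact ⟨Ioi (a : ℝ), isOpen_Ioi, hta, fun s hs => ⟨hs.1, hs.2.2⟩⟩
  · intro t ht
    set a : Ioo 0 b := ⟨t / 2, half t ⟨ht.1, ht.2.le⟩⟩
    have hta : (a : ℝ) < t := half_lt_self ht.1
    have h1 := (hφ a t ⟨hta.le, ht.2.le⟩).hasDerivAt (Icc_mem_nhds hta ht.2)
    rw [hψeq a ⟨hta, ht.2.le⟩]
    refine h1.congr_of_eventuallyEq ?_
    filter_upwards [Ioo_mem_nhds hta ht.2] with s hs
    exact hψeq a ⟨hs.1, hs.2.le⟩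

/-- The region between two graphs over a compact interval is the image of a rectangle. -/
lemma isCompact_between {l u : ℝ → ℝ} (hl : Continuous l) (hu : Continuous u) {a b : ℝ}
    (hlu : ∀ t ∈ Icc a b, l t < u t) :
    IsCompact {p : ℝ × ℝ | p.1 ∈ Icc a b ∧ p.2 ∈ Icc (l p.1) (u p.1)} := by
  have : {p : ℝ × ℝ | p.1 ∈ Icc a b ∧ p.2 ∈ Icc (l p.1) (u p.1)} =
      (fun q : ℝ × ℝ => (q.1, l q.1 + q.2 * (u q.1 - l q.1))) '' (Icc a b ×ˢ Icc 0 1) := by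
    ext ⟨t, x⟩
    constructor
    · rintro ⟨ht, hx⟩
      have hpos := sub_pos.2 (hlu t ht)
      refine ⟨(t, (x - l t) / (u t - l t)), ⟨ht, div_nonneg (sub_nonneg.2 hx.1) hpos.le, ?_⟩, ?_⟩
      · exact (div_le_one hpos).2 (sub_le_sub_right hx.2 _)
      · simp only [div_mul_cancel₀ _ hpos.ne']; simp
    · rintro ⟨⟨t', s⟩, ⟨ht, hs⟩, he⟩
      obtain ⟨rfl, rfl⟩ := Prod.mk.inj he
      have hpos := sub_pos.2 (hlu t' ht)
      refine ⟨ht, ?_, ?_⟩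
      · have := mul_nonneg hs.1 hpos.le
        dsimp only at this ⊢; linarith
      · have := mul_le_mul_of_nonneg_right hs.2 hpos.le
        dsimp only at this ⊢; linarith
  rw [this]
  exact (isCompact_Icc.prod isCompact_Icc).image (by fun_prop)

/-- A curve of initial value between the graphs of `l` and `u` at the right end of `(0, b]` extends
to a solution on `(0, b]` between these graphs, if the slopes on the graphs point outwards. -/
theorem exists_solution_between {f f' : ℝ → ℝ → ℝ} {l u l' u' : ℝ → ℝ} {b x₀ : ℝ} (hb : 0 < b)
    (hl : ∀ t, HasDerivAt l (l' t) t) (hu : ∀ t, HasDerivAt u (u' t) t)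
    (hlu : ∀ t ∈ Ioc 0 b, l t < u t)
    (hf : ContinuousOn (fun p : ℝ × ℝ => f p.1 p.2)
      {p | p.1 ∈ Ioc 0 b ∧ p.2 ∈ Icc (l p.1) (u p.1)})
    (hf' : ContinuousOn (fun p : ℝ × ℝ => f' p.1 p.2)
      {p | p.1 ∈ Ioc 0 b ∧ p.2 ∈ Icc (l p.1) (u p.1)})
    (hd : ∀ t ∈ Ioc 0 b, ∀ x ∈ Icc (l t) (u t), HasDerivAt (f t) (f' t x) x)
    (hfl : ∀ t ∈ Ioc 0 b, f t (l t) < l' t) (hfu : ∀ t ∈ Ioc 0 b, u' t < f t (u t))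
    (hlx : l b < x₀) (hxu : x₀ < u b) :
    ∃ φ : ℝ → ℝ, φ b = x₀ ∧ ContinuousOn φ (Ioc 0 b) ∧
      ∀ t ∈ Ioo 0 b, φ t ∈ Ioo (l t) (u t) ∧ HasDerivAt φ (f t (φ t)) t := by
  have hlc : Continuous l := continuous_iff_continuousAt.2 fun t => (hl t).continuousAt
  have huc : Continuous u := continuous_iff_continuousAt.2 fun t => (hu t).continuousAt
  -- Clamping `x` to `[l t, u t]` makes the field globally Lipschitz and bounded on each `[a, b]`;
  -- the barriers then show that the clamp is inactive along the solution.
  set cl : ℝ → ℝ → ℝ := fun t x => max (l t) (min x (u t)) with hcl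
  have hcl_mem : ∀ t ∈ Ioc 0 b, ∀ x, cl t x ∈ Icc (l t) (u t) := fun t ht x =>
    ⟨le_max_left _ _, max_le (hlu t ht).le (min_le_right _ _)⟩
  have hcl_eq : ∀ t x, x ∈ Icc (l t) (u t) → cl t x = x := fun t x hx => by
    simp [hcl, hx.1, hx.2]
  have hcl_lip : ∀ t, LipschitzWith 1 (cl t) := fun t =>
    (LipschitzWith.id.min_const (u t)).const_max (l t)
  have hcpt : ∀ a ∈ Ioo 0 b, IsCompact {p : ℝ × ℝ | p.1 ∈ Icc a b ∧ p.2 ∈ Icc (l p.1) (u p.1)} :=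
    fun a ha => isCompact_between hlc huc fun t ht => hlu t ⟨ha.1.trans_le ht.1, ht.2⟩
  have hsub : ∀ a ∈ Ioo 0 b, {p : ℝ × ℝ | p.1 ∈ Icc a b ∧ p.2 ∈ Icc (l p.1) (u p.1)} ⊆
      {p | p.1 ∈ Ioc 0 b ∧ p.2 ∈ Icc (l p.1) (u p.1)} :=
    fun a ha p hp => ⟨⟨ha.1.trans_le hp.1.1, hp.1.2⟩, hp.2⟩
  obtain ⟨φ, hφb, hφc, hφ⟩ := exists_solution_Ioc (g := fun t x => f t (cl t x)) hb
    (fun a ha => by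
      obtain ⟨K, hK⟩ := (hcpt a ha).exists_bound_of_continuousOn (hf'.mono (hsub a ha))
      refine ⟨K.toNNReal, fun t ht => ?_⟩
      have ht' : t ∈ Ioc 0 b := ⟨ha.1.trans_le ht.1, ht.2⟩
      have h1 : LipschitzOnWith K.toNNReal (f t) (Icc (l t) (u t)) :=
        (convex_Icc _ _).lipschitzOnWith_of_nnnorm_hasDerivWithin_le
          (fun x hx => (hd t ht' x hx).hasDerivWithinAt) fun x hx => by
            rw [← norm_toNNReal]
            exact Real.toNNReal_le_toNNReal (hK (t, x) ⟨ht, hx⟩)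
      have h2 := h1.comp ((hcl_lip t).lipschitzOnWith (s := univ)) (fun x _ => hcl_mem t ht' x)
      rw [mul_one, lipschitzOnWith_univ] at h2
      exact h2)
    (fun x => hf.comp (f := fun t => (t, cl t x)) (by
      have : Continuous fun t => cl t x := hlc.max (continuous_const.min huc)
      exact (continuous_id.prodMk this).continuousOn) fun t ht => ⟨ht, hcl_mem t ht x⟩)
    (fun a ha => by
      obtain ⟨L, hL⟩ := (hcpt a ha).exists_bound_of_continuousOn (hf.mono (hsub a ha))
      exact ⟨L.toNNReal, fun t ht x => (hL (t, cl t x)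
        ⟨ht, hcl_mem t ⟨ha.1.trans_le ht.1, ht.2⟩ x⟩).trans (Real.le_coe_toNNReal L)⟩) x₀
  have hupper := pos_of_deriv_neg_of_eq_zero (D := fun t => u t - φ t)
    (D' := fun t => u' t - f t (cl t (φ t))) (huc.continuousOn.sub hφc)
    (by simp only [hφb]; linarith) (fun t ht h0 => by
      have ht' : t ∈ Ioc 0 b := ⟨ht.1, ht.2.le⟩
      have : φ t = u t := by linarith
      rw [this, hcl_eq t _ ⟨(hlu t ht').le, le_rfl⟩]
      linarith [hfu t ht']) (fun t ht => (hu t).sub (hφ t ht))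
  have hlower := pos_of_deriv_neg_of_eq_zero (D := fun t => φ t - l t)
    (D' := fun t => f t (cl t (φ t)) - l' t) (hφc.sub hlc.continuousOn)
    (by simp only [hφb]; linarith) (fun t ht h0 => by
      have ht' : t ∈ Ioc 0 b := ⟨ht.1, ht.2.le⟩
      have : φ t = l t := by linarith
      rw [this, hcl_eq t _ ⟨le_rfl, (hlu t ht').le⟩]
      linarith [hfl t ht']) (fun t ht => (hφ t ht).sub (hl t))
  refine ⟨φ, hφb, hφc, fun t ht => ?_⟩
  have ht' : t ∈ Ioc 0 b := ⟨ht.1, ht.2.le⟩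
  have h1 := hlower t ht'
  have h2 := hupper t ht'
  have hmem : φ t ∈ Ioo (l t) (u t) := ⟨by linarith, by linarith⟩
  refine ⟨hmem, ?_⟩
  have := hφ t ht
  rwa [hcl_eq t _ (Ioo_subset_Icc_self hmem)] at this

/-! ### Mass estimates and regularity of the fields -/

lemma IsEquationOfState.contDiffAt_dEnergy {ε : ℝ → ℝ} {ρbar : ℝ} (h : IsEquationOfState ε ρbar)
    {x : ℝ} (hx : ρbar < x) : ContDiffAt ℝ 1 (dEnergy ε ρbar) x := by
  have h1 : ContDiffAt ℝ 1 (fun y => (pressure ε ρbar y + ε y) / y) x :=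
    ((h.contDiffAt_pressure hx).add (h.contDiffAt_energy hx)).div contDiffAt_id (h.pos_of_lt hx).ne'
  refine h1.congr_of_eventuallyEq ?_
  filter_upwards [Ioi_mem_nhds hx] with y hy
  exact dEnergy_eq (h.pos_of_lt hy).ne'

namespace SphericalFluid

variable {F : SphericalFluid}

/-- Third-order estimates near the centre for the mass and its derivatives. -/
structure MassEstimates (F : SphericalFluid) (h c C δ : ℝ) (D₂ D₃ : ℝ → ℝ → ℝ) : Prop where
  h_pos : 0 < h
  C_pos : 0 < C
  δ_pos : 0 < δ
  δ_le : δ ≤ F.rmax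
  analytic : ∀ r ∈ Ioo 0 δ, ∀ R ∈ Icc 0 r, AnalyticAt ℝ (fun x : ℝ × ℝ => F.Ψ x.1 x.2) (r, R)
  mass : ∀ r ∈ Ioo 0 δ, ∀ R ∈ Icc 0 r, |2 * F.Ψ r R - h * r ^ 3 + 2 * c / 3 * R ^ 3| ≤ C * r ^ 5
  massr : ∀ r ∈ Ioo 0 δ, ∀ R ∈ Icc 0 r, |F.massr r R - 3 * h / 2 * r ^ 2| ≤ C * r ^ 4
  massR : ∀ r ∈ Ioo 0 δ, ∀ R ∈ Icc 0 r, |F.massR r R + c * R ^ 2| ≤ C * r ^ 4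
  hasDerivAt_massR : ∀ r ∈ Ioo 0 δ, ∀ R ∈ Icc 0 r, HasDerivAt (F.massR r) (D₂ r R) R
  D₂_le : ∀ r ∈ Ioo 0 δ, ∀ R ∈ Icc 0 r, |D₂ r R + 2 * c * R| ≤ C * r ^ 3
  hasDerivAt_D₂ : ∀ r ∈ Ioo 0 δ, ∀ R ∈ Icc 0 r, HasDerivAt (D₂ r) (D₃ r R) R
  D₃_le : ∀ r ∈ Ioo 0 δ, ∀ R ∈ Icc 0 r, |D₃ r R + 2 * c| ≤ C * r ^ 2

lemma IsCollapse.exists_massEstimates (hF : F.IsCollapse) {h ε₀ p₀ : ℝ}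
    (hmass : F.HasMassExpansion h ε₀ p₀) :
    ∃ c C δ D₂ D₃, F.MassEstimates h c C δ D₂ D₃ := by
  obtain ⟨hh, -, -, -, -, hexp⟩ := hmass
  obtain ⟨C, hC, δ, hδ, D₂, D₃, hest⟩ := exists_cubic_estimates hF.mass_analytic hF.mass_odd hexp
  set α := p₀ / (ε₀ + p₀)
  have key : ∀ r ∈ Ioo 0 (min δ F.rmax), ∀ R ∈ Icc 0 r, |r| < δ ∧ |R| ≤ |r| ∧ |r| = r := by
    intro r hr R hR
    rw [abs_of_pos hr.1, abs_of_nonneg hR.1]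
    exact ⟨hr.2.trans_le (min_le_left _ _), hR.2, rfl⟩
  -- With `c = 3hα/2` the leading part of `Ψ,R` is `-c R²`. The error constant is doubled because
  -- the mass estimate concerns `2Ψ`.
  refine ⟨3 * h * α / 2, 2 * C, min δ F.rmax, D₂, D₃, hh, by positivity, lt_min hδ hF.rmax_pos,
    min_le_right _ _, ?_, ?_, ?_, ?_, ?_, ?_, ?_, ?_⟩ <;> intro r hr R hR <;>
    obtain ⟨h1, h2, h3⟩ := key r hr R hR <;>
    obtain ⟨e1, e2, e3, e4, e5, e6, e7, e8⟩ := hest r R h1 h2 <;>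
    rw [h3] at e2 e3 e4 e6 e8 <;>
    have hr0 := hr.1
  · exact e1
  · have : 2 * F.Ψ r R - h * r ^ 3 + 2 * (3 * h * α / 2) / 3 * R ^ 3 =
        2 * (F.Ψ r R - h / 2 * (r ^ 3 - α * R ^ 3)) := by ring
    rw [this, abs_mul, abs_two]; linarith
  · have : 0 ≤ C * r ^ 4 := by positivity
    unfold SphericalFluid.massr; linarith
  · have : 0 ≤ C * r ^ 4 := by positivity
    unfold SphericalFluid.massR; linarith
  · exact e5
  · have : 0 ≤ C * r ^ 3 := by positivity
    rw [show 2 * (3 * h * α / 2) * R = 3 * h * α * R by ring]; linarith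
  · exact e7
  · have : 0 ≤ C * r ^ 2 := by positivity
    rw [show 2 * (3 * h * α / 2) = 3 * h * α by ring]; linarith

lemma energy_add_press (F : SphericalFluid) (r R : ℝ) :
    F.energy r R + F.press r R = F.ρ r R * F.enthalpy r R := by
  simp [energy, press, enthalpy, pressure]

section basic

variable (hF : F.IsCollapse) {r R : ℝ} (hr : r ∈ Ioo 0 F.rmax) (hR : R ∈ Ioc 0 r)
include hF hr hR

/-- At `ρ̄` the energy vanishes, and dominant energy would exclude positive pressure. -/
lemma IsCollapse.rhobar_lt : F.ρbar < F.ρ r R := by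
  refine lt_of_le_of_ne (hF.density_mem r hr R hR) fun he => ?_
  have h1 := hF.press_pos r hr R hR
  have h2 := hF.dominant_energy r hr R hR
  have h3 : F.energy r R = 0 :=
    (hF.eos.energy_eq_zero_iff _ (hF.density_mem r hr R hR)).2 he.symm
  linarith

lemma IsCollapse.density_pos : 0 < F.ρ r R := hF.eos.pos_of_lt (hF.rhobar_lt hr hR)

lemma IsCollapse.enthalpy_pos : 0 < F.enthalpy r R := hF.eos.dEnergy_pos (hF.rhobar_lt hr hR)

lemma IsCollapse.Y_pos : 0 < F.Y r R :=
  div_pos (mul_pos (hF.E_pos r hr) (hF.massr_pos r hr R hR)) (hF.enthalpy_pos hr hR)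

lemma IsCollapse.press_mul : 4 * Real.pi * R ^ 2 * F.press r R = -F.massR r R := by
  have hR0 := hR.1
  rw [hF.press_eq r hr R hR]; field_simp

lemma IsCollapse.massR_neg : F.massR r R < 0 := by
  have h1 := hF.press_mul hr hR
  have h2 : 0 < 4 * Real.pi * R ^ 2 * F.press r R := by
    have := hF.press_pos r hr R hR
    have := hR.1
    positivity
  linarith

lemma IsCollapse.Rprime_pos : 0 < F.Rprime r R := by
  have := hF.press_pos r hr R hR
  have := hF.dominant_energy r hr R hR
  have := hF.massr_pos r hr R hR
  have := hR.1
  unfold Rprime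
  have : 0 < F.energy r R + F.press r R := by linarith
  positivity

end basic

section regularity

variable {h c C δ : ℝ} {D₂ D₃ : ℝ → ℝ → ℝ}

lemma eventually_mem_wedge {δ r R : ℝ} (hr : r < δ) (hR : R ∈ Ioo 0 r) :
    ∀ᶠ x : ℝ × ℝ in 𝓝 (r, R), x.1 < δ ∧ x.2 ∈ Ioo 0 x.1 := by
  have : IsOpen {x : ℝ × ℝ | x.1 < δ ∧ 0 < x.2 ∧ x.2 < x.1} :=
    (isOpen_lt continuous_fst continuous_const).inter
      ((isOpen_lt continuous_const continuous_snd).inter (isOpen_lt continuous_snd continuous_fst))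
  exact this.mem_nhds ⟨hr, hR⟩

variable (hF : F.IsCollapse) (hM : F.MassEstimates h c C δ D₂ D₃) {r R : ℝ} (hr : r < δ)
  (hR : R ∈ Ioo 0 r)
include hM

lemma MassEstimates.mem_rmax (hr : r ∈ Ioo 0 δ) : r ∈ Ioo 0 F.rmax := ⟨hr.1, hr.2.trans_le hM.δ_le⟩

lemma MassEstimates.hasDerivAt_mass_snd {r R : ℝ} (hr : r ∈ Ioo 0 δ) (hR : R ∈ Icc 0 r) :
    HasDerivAt (F.Ψ r) (F.massR r R) R :=
  (hM.analytic r hr R hR).hasDerivAt_snd.differentiableAt.hasDerivAt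

include hr hR

lemma MassEstimates.contDiffAt_mass : ContDiffAt ℝ 1 (fun x : ℝ × ℝ => F.Ψ x.1 x.2) (r, R) :=
  (hM.analytic r ⟨hR.1.trans hR.2, hr⟩ R ⟨hR.1.le, hR.2.le⟩).contDiffAt

lemma MassEstimates.contDiffAt_massr : ContDiffAt ℝ 1 (fun x : ℝ × ℝ => F.massr x.1 x.2) (r, R) := by
  have h1 := hM.analytic r ⟨hR.1.trans hR.2, hr⟩ R ⟨hR.1.le, hR.2.le⟩
  refine (h1.fderiv_apply (1, 0)).contDiffAt.congr_of_eventuallyEq ?_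
  filter_upwards [h1.eventually_analyticAt] with x hx
  exact (AnalyticAt.hasDerivAt_fst (r := x.1) (R := x.2) hx).deriv

lemma MassEstimates.contDiffAt_massR : ContDiffAt ℝ 1 (fun x : ℝ × ℝ => F.massR x.1 x.2) (r, R) := by
  have h1 := hM.analytic r ⟨hR.1.trans hR.2, hr⟩ R ⟨hR.1.le, hR.2.le⟩
  refine (h1.fderiv_apply (0, 1)).contDiffAt.congr_of_eventuallyEq ?_
  filter_upwards [h1.eventually_analyticAt] with x hx
  exact (AnalyticAt.hasDerivAt_snd (r := x.1) (R := x.2) hx).deriv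

include hF

lemma MassEstimates.contDiffAt_press : ContDiffAt ℝ 1 (fun x : ℝ × ℝ => F.press x.1 x.2) (r, R) := by
  have h1 : ContDiffAt ℝ 1 (fun x : ℝ × ℝ => -F.massR x.1 x.2 / (4 * Real.pi * x.2 ^ 2)) (r, R) := by
    refine (hM.contDiffAt_massR hr hR).neg.div (contDiffAt_const.mul (contDiffAt_snd.pow 2)) ?_
    have := hR.1
    positivity
  refine h1.congr_of_eventuallyEq ?_
  filter_upwards [eventually_mem_wedge hr hR] with x hx
  exact hF.press_eq x.1 (hM.mem_rmax ⟨hx.2.1.trans hx.2.2, hx.1⟩) x.2 ⟨hx.2.1, hx.2.2.le⟩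

/-- The density is a `C¹` function, since it is determined by the pressure. -/
lemma MassEstimates.contDiffAt_density : ContDiffAt ℝ 1 (fun x : ℝ × ℝ => F.ρ x.1 x.2) (r, R) := by
  have hr' := hM.mem_rmax (r := r) ⟨hR.1.trans hR.2, hr⟩
  have hlt := hF.rhobar_lt hr' ⟨hR.1, hR.2.le⟩
  have hp0 := hF.press_pos r hr' R ⟨hR.1, hR.2.le⟩
  have hP := hF.eos.contDiffAt_pressure hlt
  have hd := hF.eos.hasDerivAt_pressure hlt
  have hd0 := (hF.eos.derivWithin_pressure_pos hlt hp0).ne'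
  set P := pressure F.ε F.ρbar with hPdef
  set d := derivWithin P (Ici F.ρbar) (F.ρ r R)
  have hfd : HasFDerivAt P
      ((ContinuousLinearEquiv.unitsEquivAut ℝ (Units.mk0 d hd0) : ℝ ≃L[ℝ] ℝ) : ℝ →L[ℝ] ℝ)
      (F.ρ r R) := by
    have : ((ContinuousLinearEquiv.unitsEquivAut ℝ (Units.mk0 d hd0) : ℝ ≃L[ℝ] ℝ) : ℝ →L[ℝ] ℝ) =
        ContinuousLinearMap.toSpanSingleton ℝ d := by ext; simp
    rw [this]
    exact hd.hasFDerivAt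
  set g := hP.localInverse hfd one_ne_zero with hg
  have hgc : ContDiffAt ℝ 1 g (P (F.ρ r R)) := hP.to_localInverse hfd one_ne_zero
  have hg0 : g (P (F.ρ r R)) = F.ρ r R := hP.localInverse_apply_image hfd one_ne_zero
  have hgr : ∀ᶠ y in 𝓝 (P (F.ρ r R)), P (g y) = y :=
    (hP.hasStrictFDerivAt' hfd one_ne_zero).eventually_right_inverse
  have hpc := hM.contDiffAt_press hF hr hR
  have hcomp : ContDiffAt ℝ 1 (fun x : ℝ × ℝ => g (F.press x.1 x.2)) (r, R) :=
    ContDiffAt.comp (r, R) (g := g) (f := fun x : ℝ × ℝ => F.press x.1 x.2) hgc hpc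
  refine hcomp.congr_of_eventuallyEq ?_
  have h1 : ∀ᶠ x in 𝓝 (r, R), F.ρbar < g (F.press x.1 x.2) := by
    refine hcomp.continuousAt.eventually (Ioi_mem_nhds ?_)
    change F.ρbar < g (P (F.ρ r R))
    rwa [hg0]
  filter_upwards [eventually_mem_wedge hr hR, h1, hpc.continuousAt.eventually hgr] with x hx hx1 hx2
  have hx1' := hM.mem_rmax (r := x.1) ⟨hx.2.1.trans hx.2.2, hx.1⟩
  -- The local inverse yields a density with the same positive pressure as `ρ`, and `p` is injective
  -- where it is positive.
  exact hF.eos.eq_of_pressure_eq (hF.rhobar_lt hx1' ⟨hx.2.1, hx.2.2.le⟩) hx1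
    (hF.press_pos _ hx1' _ ⟨hx.2.1, hx.2.2.le⟩) hx2.symm

/-- The dominant energy condition for all densities above one which is attained. -/
lemma MassEstimates.dominant_of_le {b : ℝ} (hb : F.ρ r R ≤ b) : pressure F.ε F.ρbar b ≤ F.ε b := by
  have hr0 : r ∈ Ioo 0 δ := ⟨hR.1.trans hR.2, hr⟩
  have hr' := hM.mem_rmax hr0
  -- The density diverges at `R = 0` and is continuous along the shell, so the value `b` is
  -- attained, and dominant energy applies at that point.
  obtain ⟨R', hbR', hR'⟩ :=
    (((hF.density_diverges r hr').eventually_ge_atTop b).and (Ioo_mem_nhdsGT hR.1)).exists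
  have hcont : ContinuousOn (F.ρ r) (Icc R' R) := fun S hS => by
    have h1 := (hM.contDiffAt_density hF (R := S) hr
      ⟨hR'.1.trans_le hS.1, hS.2.trans_lt hR.2⟩).continuousAt
    exact (ContinuousAt.comp (f := fun s : ℝ => (r, s)) h1
      (by fun_prop)).continuousWithinAt
  obtain ⟨S, hS, rfl⟩ := intermediate_value_Icc' hR'.2.le hcont ⟨hb, hbR'⟩
  exact hF.dominant_energy r hr' S ⟨hR'.1.trans_le hS.1, hS.2.trans hR.2.le⟩

lemma MassEstimates.contDiffAt_enthalpy :
    ContDiffAt ℝ 1 (fun x : ℝ × ℝ => F.enthalpy x.1 x.2) (r, R) :=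
  ContDiffAt.comp (r, R) (g := dEnergy F.ε F.ρbar) (f := fun x : ℝ × ℝ => F.ρ x.1 x.2)
    (hF.eos.contDiffAt_dEnergy (hF.rhobar_lt (hM.mem_rmax ⟨hR.1.trans hR.2, hr⟩) ⟨hR.1, hR.2.le⟩))
    (hM.contDiffAt_density hF hr hR)

lemma MassEstimates.contDiffAt_Rprime : ContDiffAt ℝ 1 (fun x : ℝ × ℝ => F.Rprime x.1 x.2) (r, R) := by
  have hr' := hM.mem_rmax (r := r) ⟨hR.1.trans hR.2, hr⟩
  have hR' : R ∈ Ioc 0 r := ⟨hR.1, hR.2.le⟩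
  have he : ContDiffAt ℝ 1 (fun x : ℝ × ℝ => F.energy x.1 x.2) (r, R) :=
    ContDiffAt.comp (r, R) (g := F.ε) (f := fun x : ℝ × ℝ => F.ρ x.1 x.2)
      (hF.eos.contDiffAt_energy (hF.rhobar_lt hr' hR')) (hM.contDiffAt_density hF hr hR)
  refine (hM.contDiffAt_massr hr hR).div ((contDiffAt_const.mul (contDiffAt_snd.pow 2)).mul
    (he.add (hM.contDiffAt_press hF hr hR))) ?_
  have h1 := F.energy_add_press r R
  have h2 := mul_pos (hF.density_pos hr' hR') (hF.enthalpy_pos hr' hR')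
  have h3 : F.energy r R + F.press r R ≠ 0 := by rw [h1]; exact h2.ne'
  have := hR.1
  positivity

end regularity

end SphericalFluid

/-! ### Regularity of the null slope -/

namespace SphericalFluid

variable {F : SphericalFluid} {h c C δ : ℝ} {D₂ D₃ : ℝ → ℝ → ℝ}

/-- The slope `dR/dr` of outgoing radial null geodesics. -/
def outgoingSlope (F : SphericalFluid) (r R : ℝ) : ℝ := F.Rprime r R * (1 - F.u r R / F.Y r R)

/-- The slope of outgoing radial null geodesics, with the value of `E` as an independent variable
(the first one). -/
def slopeWith (F : SphericalFluid) (q : ℝ × ℝ × ℝ) : ℝ :=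
  F.Rprime q.2.1 q.2.2 * (1 - Real.sqrt (2 * F.Ψ q.2.1 q.2.2 / q.2.2 +
    (q.1 * F.massr q.2.1 q.2.2 / F.enthalpy q.2.1 q.2.2) ^ 2 - 1) /
      (q.1 * F.massr q.2.1 q.2.2 / F.enthalpy q.2.1 q.2.2))

/-- The derivative of the slope of outgoing radial null geodesics with respect to `R`. -/
def outgoingSlopeR (F : SphericalFluid) (r R : ℝ) : ℝ :=
  fderiv ℝ F.slopeWith (F.E r, r, R) (0, 0, 1)

variable (hF : F.IsCollapse) (hM : F.MassEstimates h c C δ D₂ D₃) {r R : ℝ} (hr : r < δ)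
  (hR : R ∈ Ioo 0 r)
include hF hM hr hR

/-- `E` is only continuous, so the slope need not be `C¹` in `(r, R)`. With the value of `E` as a
separate variable it is, and composing with `(r, R) ↦ (E r, r, R)` gives the continuity of the slope
and of its `R`-derivative that the existence theorem needs. -/
lemma MassEstimates.contDiffAt_slopeWith : ContDiffAt ℝ 1 F.slopeWith (F.E r, r, R) := by
  have hr' := hM.mem_rmax (r := r) ⟨hR.1.trans hR.2, hr⟩
  have hR' : R ∈ Ioc 0 r := ⟨hR.1, hR.2.le⟩
  have hsnd : ContDiffAt ℝ 1 (Prod.snd : ℝ × ℝ × ℝ → ℝ × ℝ) (F.E r, r, R) := contDiffAt_snd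
  have lift : ∀ {k : ℝ × ℝ → ℝ}, ContDiffAt ℝ 1 k (r, R) →
      ContDiffAt ℝ 1 (fun q : ℝ × ℝ × ℝ => k q.2) (F.E r, r, R) :=
    fun {k} hk => ContDiffAt.comp (F.E r, r, R) (g := k) (f := Prod.snd) hk hsnd
  have hY : ContDiffAt ℝ 1
      (fun q : ℝ × ℝ × ℝ => q.1 * F.massr q.2.1 q.2.2 / F.enthalpy q.2.1 q.2.2) (F.E r, r, R) :=
    (contDiffAt_fst.mul (lift (hM.contDiffAt_massr hr hR))).div
      (lift (hM.contDiffAt_enthalpy hF hr hR)) (hF.enthalpy_pos hr' hR').ne'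
  refine (lift (hM.contDiffAt_Rprime hF hr hR)).mul (contDiffAt_const.sub
    (ContDiffAt.div (ContDiffAt.sqrt (((ContDiffAt.div (contDiffAt_const.mul
      (lift (hM.contDiffAt_mass hr hR))) (lift contDiffAt_snd) hR.1.ne').add (hY.pow 2)).sub
      contDiffAt_const) ?_) hY ?_))
  · exact (hF.uSq_pos r hr' R hR).ne'
  · exact (hF.Y_pos hr' hR').ne'

lemma MassEstimates.continuousAt_prodMk_E :
    ContinuousAt (fun p : ℝ × ℝ => (F.E p.1, p.1, p.2)) (r, R) := by
  have hr' := hM.mem_rmax (r := r) ⟨hR.1.trans hR.2, hr⟩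
  have hE : ContinuousAt F.E r := hF.E_continuous.continuousAt (Ioo_mem_nhds hr'.1 hr'.2)
  exact (ContinuousAt.comp (f := Prod.fst) (x := (r, R)) hE continuousAt_fst).prodMk
    (continuousAt_fst.prodMk continuousAt_snd)

lemma MassEstimates.continuousAt_outgoingSlope :
    ContinuousAt (fun p : ℝ × ℝ => F.outgoingSlope p.1 p.2) (r, R) :=
  ContinuousAt.comp (f := fun p : ℝ × ℝ => (F.E p.1, p.1, p.2)) (g := F.slopeWith)
    (hM.contDiffAt_slopeWith hF hr hR).continuousAt (hM.continuousAt_prodMk_E hF hr hR)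

lemma MassEstimates.continuousAt_outgoingSlopeR :
    ContinuousAt (fun p : ℝ × ℝ => F.outgoingSlopeR p.1 p.2) (r, R) := by
  have h1 : ContinuousAt (fderiv ℝ F.slopeWith) (F.E r, r, R) :=
    ((hM.contDiffAt_slopeWith hF hr hR).fderiv_right (m := 0) (by norm_num)).continuousAt
  exact (ContinuousAt.comp (f := fun p : ℝ × ℝ => (F.E p.1, p.1, p.2)) h1
    (hM.continuousAt_prodMk_E hF hr hR)).clm_apply continuousAt_const

lemma MassEstimates.hasDerivAt_outgoingSlope :
    HasDerivAt (F.outgoingSlope r) (F.outgoingSlopeR r R) R :=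
  ((hM.contDiffAt_slopeWith hF hr hR).differentiableAt one_ne_zero).hasFDerivAt.comp_hasDerivAt
    (f := fun s : ℝ => (F.E r, r, s)) R
    ((hasDerivAt_const R _).prodMk ((hasDerivAt_const R _).prodMk (hasDerivAt_id R)))

end SphericalFluid

/-! ### Bounds near the centre -/

lemma eventually_mul_pow_le (K : ℝ) {n : ℕ} (hn : n ≠ 0) {η : ℝ} (hη : 0 < η) :
    ∀ᶠ r in 𝓝[>] (0 : ℝ), K * r ^ n ≤ η := by
  have : Tendsto (fun r : ℝ => K * r ^ n) (𝓝[>] 0) (𝓝 0) := by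
    have h1 : Tendsto (fun r : ℝ => K * r ^ n) (𝓝 0) (𝓝 (K * 0 ^ n)) :=
      (continuous_const.mul (continuous_id.pow n)).tendsto 0
    rw [zero_pow hn, mul_zero] at h1
    exact h1.mono_left nhdsWithin_le_nhds
  exact this.eventually (Iic_mem_nhds hη)

namespace SphericalFluid

variable {F : SphericalFluid} {h c C δ : ℝ} {D₂ D₃ : ℝ → ℝ → ℝ}

lemma MassEstimates.eventually_mem (hM : F.MassEstimates h c C δ D₂ D₃) :
    ∀ᶠ r in 𝓝[>] (0 : ℝ), r ∈ Ioo 0 δ := Ioo_mem_nhdsGT hM.δ_pos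

/-- For `R ≤ x r³` the term in `R³` is `O(r⁹)`, so only `h r³` matters. -/
lemma MassEstimates.eventually_mass (hM : F.MassEstimates h c C δ D₂ D₃) {x η : ℝ} (hη : 0 < η) :
    ∀ᶠ r in 𝓝[>] (0 : ℝ), x * r ^ 3 < r ∧
      ∀ R ∈ Icc 0 (x * r ^ 3), |2 * F.Ψ r R - h * r ^ 3| ≤ η * r ^ 3 := by
  filter_upwards [hM.eventually_mem, eventually_mul_pow_le C two_ne_zero (half_pos hη),
    eventually_mul_pow_le (|2 * c / 3| * x ^ 3) (n := 6) (by norm_num) (half_pos hη),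
    eventually_mul_pow_le x two_ne_zero one_half_pos] with r hr h1 h2 h3
  have hr0 := hr.1
  have hxr : x * r ^ 3 < r := by nlinarith
  refine ⟨hxr, fun R hR => ?_⟩
  have h4 := abs_le.1 (hM.mass r hr R ⟨hR.1, hR.2.trans hxr.le⟩)
  have h5 : |2 * c / 3 * R ^ 3| ≤ η / 2 * r ^ 3 := by
    rw [abs_mul, abs_of_nonneg (pow_nonneg hR.1 3)]
    calc |2 * c / 3| * R ^ 3 ≤ |2 * c / 3| * (x * r ^ 3) ^ 3 := by
          gcongr
          · exact hR.1
          · exact hR.2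
      _ = |2 * c / 3| * x ^ 3 * r ^ 6 * r ^ 3 := by ring
      _ ≤ _ := by gcongr
  have h6 : C * r ^ 5 ≤ η / 2 * r ^ 3 := by
    calc C * r ^ 5 = C * r ^ 2 * r ^ 3 := by ring
      _ ≤ _ := by gcongr
  have h7 := abs_le.1 h5
  rw [abs_le]
  constructor <;> linarith [h4.1, h4.2, h7.1, h7.2]

lemma MassEstimates.eventually_massr (hM : F.MassEstimates h c C δ D₂ D₃) {η : ℝ} (hη : 0 < η) :
    ∀ᶠ r in 𝓝[>] (0 : ℝ), ∀ R ∈ Icc 0 r,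
      F.massr r R ∈ Icc ((1 - η) * (3 * h / 2 * r ^ 2)) ((1 + η) * (3 * h / 2 * r ^ 2)) := by
  have hh := hM.h_pos
  filter_upwards [hM.eventually_mem,
    eventually_mul_pow_le C two_ne_zero (η := η * (3 * h / 2)) (by positivity)] with r hr h1 R hR
  have h2 := abs_le.1 (hM.massr r hr R hR)
  have h3 : C * r ^ 4 ≤ η * (3 * h / 2) * r ^ 2 := by
    calc C * r ^ 4 = C * r ^ 2 * r ^ 2 := by ring
      _ ≤ _ := by gcongr
  constructor <;> linarith [h2.1, h2.2]

variable (hF : F.IsCollapse) (hM : F.MassEstimates h c C δ D₂ D₃)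
include hF hM

/-- The initial density is bounded near the centre, by a density above which the dominant energy
condition holds. -/
lemma MassEstimates.exists_density_bound {ε₀ : ℝ}
    (hε : Tendsto (fun r => F.energy r r) (𝓝[>] 0) (𝓝 ε₀)) :
    ∃ b, F.ρbar < b ∧ 0 < pressure F.ε F.ρbar b ∧ (∀ᶠ r in 𝓝[>] 0, F.ρ r r ≤ b) ∧
      ∀ x ≥ b, pressure F.ε F.ρbar x ≤ F.ε x := by
  have hδ := hM.δ_pos
  have hR : δ / 4 ∈ Ioo 0 (δ / 2) := ⟨by linarith, by linarith⟩
  have hr : δ / 2 < δ := by linarith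
  have hr' := hM.mem_rmax (r := δ / 2) ⟨by linarith, hr⟩
  set a := F.ρ (δ / 2) (δ / 4) with ha
  have ha0 : F.ρbar < a := hF.rhobar_lt hr' ⟨hR.1, hR.2.le⟩
  have hpa : 0 < pressure F.ε F.ρbar a := hF.press_pos _ hr' _ ⟨hR.1, hR.2.le⟩
  have hεa := hF.eos.energy_pos ha0
  have ha' := hF.eos.pos_of_lt ha0
  -- For `ρ ≥ a`, monotonicity of `ε/ρ` gives `ρ ≤ ε(ρ) a / ε(a)`, and `ε < ε₀ + 1` on the initial
  -- surface near the centre.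
  refine ⟨max a ((ε₀ + 1) * a / F.ε a), ha0.trans_le (le_max_left _ _),
    hF.eos.pressure_pos_of_le ha0 hpa (le_max_left _ _), ?_, fun x hx =>
      hM.dominant_of_le hF hr hR ((le_max_left _ _).trans hx)⟩
  filter_upwards [hM.eventually_mem, hε.eventually (Iio_mem_nhds (lt_add_one ε₀))] with r hr h1
  rcases le_total (F.ρ r r) a with hle | hle
  · exact hle.trans (le_max_left _ _)
  · refine le_trans ?_ (le_max_right _ _)
    have h2 := hF.eos.energy_div_le ha0 hle
    have h3 := ha'.trans_le hle
    rw [div_le_div_iff₀ ha' h3] at h2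
    rw [le_div_iff₀ hεa]
    have h4 : F.ε (F.ρ r r) < ε₀ + 1 := h1
    nlinarith

/-- On `R = r` the estimate for `Ψ,R` says `4π p(r, r) = c + O(r²)`. -/
lemma MassEstimates.massR_coeff_le {b : ℝ} (hb : ∀ᶠ r in 𝓝[>] 0, F.ρ r r ≤ b) :
    c ≤ 4 * Real.pi * pressure F.ε F.ρbar b := by
  have h0 : Tendsto (fun r : ℝ => 4 * Real.pi * pressure F.ε F.ρbar b + C * r ^ 2) (𝓝[>] 0)
      (𝓝 (4 * Real.pi * pressure F.ε F.ρbar b + C * 0 ^ 2)) :=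
    ((continuous_const.add (continuous_const.mul (continuous_id.pow 2))).tendsto 0).mono_left
      nhdsWithin_le_nhds
  rw [zero_pow two_ne_zero, mul_zero, add_zero] at h0
  refine ge_of_tendsto h0 ?_
  filter_upwards [hM.eventually_mem, hb] with r hr hrb
  have hr' := hM.mem_rmax hr
  have hrr : r ∈ Ioc 0 r := ⟨hr.1, le_rfl⟩
  have h1 := abs_le.1 (hM.massR r hr r ⟨hr.1.le, le_rfl⟩)
  have h2 := hF.press_mul hr' hrr
  have h3 : F.press r r ≤ pressure F.ε F.ρbar b :=
    hF.eos.pressure_le_of_le (hF.rhobar_lt hr' hrr) (hF.press_pos r hr' r hrr) hrb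
  have h4 : 4 * Real.pi * r ^ 2 * F.press r r ≤
      4 * Real.pi * r ^ 2 * pressure F.ε F.ρbar b := by
    have := Real.pi_pos
    gcongr
  have h5 : 0 < r ^ 2 := pow_pos hr.1 2
  refine le_of_mul_le_mul_left ?_ h5
  nlinarith [h1.1, h1.2]

/-- The pressure is unbounded as a function of the density. -/
lemma MassEstimates.exists_lt_pressure {b : ℝ} (hbρ : F.ρbar < b)
    (hbp : 0 < pressure F.ε F.ρbar b) (hb : ∀ᶠ r in 𝓝[>] 0, F.ρ r r ≤ b) (M : ℝ) :
    ∃ x > b, M < pressure F.ε F.ρbar x := by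
  by_contra! hbd
  have hc := hM.massR_coeff_le hF hb
  have hpi := Real.pi_pos
  have hmono := hF.eos.pressure_strictMonoOn hbρ hbp (self_mem_Ici) (show b + 1 ∈ Ici b from
    (lt_add_one b).le) (lt_add_one b)
  set p₁ := pressure F.ε F.ρbar (b + 1) with hp₁
  set p₂ := pressure F.ε F.ρbar b with hp₂
  have hM0 : 0 ≤ M := (hbp.le.trans hmono.le).trans (hbd (b + 1) (lt_add_one b))
  -- If `p ≤ M`, then `Ψ,R = O(R²)` on each shell, so `Ψ,R` and `Ψ,RR` vanish at `R = 0`.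
  -- Integrating the bound for `Ψ,RRR` twice gives `4π p ≤ c + C r²`, while the diverging density
  -- makes `p ≥ p₁` somewhere on the shell. As `r → 0` this contradicts `c ≤ 4π p₂ < 4π p₁`.
  have hle : ∀ᶠ r in 𝓝[>] (0 : ℝ), 4 * Real.pi * p₁ ≤ c + C * r ^ 2 := by
    filter_upwards [hM.eventually_mem] with r hr
    have hr' := hM.mem_rmax hr
    have hr0 := hr.1
    have h0r : (0 : ℝ) ∈ Icc 0 r := ⟨le_rfl, hr.1.le⟩
    have hub : ∀ R ∈ Ioc 0 r, -F.massR r R ≤ 4 * Real.pi * M * R ^ 2 := by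
      intro R hR
      rw [← hF.press_mul hr' hR]
      have : F.press r R ≤ M := by
        rcases le_or_gt (F.ρ r R) b with h1 | h1
        · exact ((hF.eos.pressure_le_of_le (hF.rhobar_lt hr' hR) (hF.press_pos r hr' R hR) h1).trans
            hmono.le).trans (hbd _ (lt_add_one b))
        · exact hbd _ h1
      have := hR.1
      calc 4 * Real.pi * R ^ 2 * F.press r R ≤ 4 * Real.pi * R ^ 2 * M := by gcongr
        _ = _ := by ring
    have hIoc : ∀ᶠ R in 𝓝[>] (0 : ℝ), R ∈ Ioc 0 r := Ioc_mem_nhdsGT hr.1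
    have htend : ∀ K : ℝ, ∀ n : ℕ, n ≠ 0 → Tendsto (fun R : ℝ => K * R ^ n) (𝓝[>] 0) (𝓝 0) := by
      intro K n hn
      have h1 : Tendsto (fun R : ℝ => K * R ^ n) (𝓝 0) (𝓝 (K * 0 ^ n)) :=
        (continuous_const.mul (continuous_id.pow n)).tendsto 0
      rw [zero_pow hn, mul_zero] at h1
      exact h1.mono_left nhdsWithin_le_nhds
    have hG0 : F.massR r 0 = 0 := by
      have h1 : Tendsto (fun R => -F.massR r R) (𝓝[>] 0) (𝓝 (-F.massR r 0)) :=
        (hM.hasDerivAt_massR r hr 0 h0r).continuousAt.neg.tendsto.mono_left nhdsWithin_le_nhds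
      have h2 := tendsto_of_tendsto_of_tendsto_of_le_of_le' tendsto_const_nhds
        (htend (4 * Real.pi * M) 2 two_ne_zero)
        (hIoc.mono fun R hR => (neg_pos.2 (hF.massR_neg hr' hR)).le) (hIoc.mono hub)
      linarith [tendsto_nhds_unique h1 h2]
    have hD0 : D₂ r 0 = 0 := by
      have h1 : Tendsto (fun R => R⁻¹ * (-F.massR r R)) (𝓝[>] 0) (𝓝 (-D₂ r 0)) := by
        have := ((hM.hasDerivAt_massR r hr 0 h0r).neg.hasDerivWithinAt (s := Ioi 0))
        rw [hasDerivWithinAt_iff_tendsto_slope' (by simp)] at this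
        refine this.congr fun R => ?_
        simp [slope_def_module, hG0]
      have h2 := tendsto_of_tendsto_of_tendsto_of_le_of_le' tendsto_const_nhds
        (htend (4 * Real.pi * M) 1 one_ne_zero)
        (hIoc.mono fun R hR => mul_nonneg (inv_nonneg.2 hR.1.le)
          (neg_pos.2 (hF.massR_neg hr' hR)).le) (hIoc.mono fun R hR => by
            have h3 := hub R hR
            have hR0 := hR.1
            rw [inv_mul_le_iff₀ hR0]; linarith)
      linarith [tendsto_nhds_unique h1 h2]
    -- integrate the bound for the third derivative twice
    have hD2 : ∀ R ∈ Icc 0 r, -D₂ r R ≤ (2 * c + C * r ^ 2) * R := by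
      intro R hR
      have hd : ∀ S ∈ Icc 0 r, HasDerivAt (fun S => (2 * c + C * r ^ 2) * S + D₂ r S)
          ((2 * c + C * r ^ 2) * 1 + D₃ r S) S := fun S hS =>
        ((hasDerivAt_id S).const_mul _).add (hM.hasDerivAt_D₂ r hr S hS)
      have hm := monotoneOn_of_deriv_nonneg (convex_Icc 0 r)
        (fun S hS => (hd S hS).continuousAt.continuousWithinAt)
        (fun S hS => (hd S (interior_subset hS)).differentiableAt.differentiableWithinAt)
        (fun S hS => by
          rw [(hd S (interior_subset hS)).deriv]
          linarith [(abs_le.1 (hM.D₃_le r hr S (interior_subset hS))).1]) h0r hR hR.1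
      simp only [hD0] at hm
      linarith
    have hG : ∀ R ∈ Icc 0 r, -F.massR r R ≤ (c + C * r ^ 2 / 2) * R ^ 2 := by
      intro R hR
      have hd : ∀ S ∈ Icc 0 r, HasDerivAt (fun S => (c + C * r ^ 2 / 2) * S ^ 2 + F.massR r S)
          ((c + C * r ^ 2 / 2) * (2 * S) + D₂ r S) S := fun S hS => by
        exact (((hasDerivAt_pow 2 S).const_mul (c + C * r ^ 2 / 2)).add
          (hM.hasDerivAt_massR r hr S hS)).congr_deriv (by norm_num)
      have hm := monotoneOn_of_deriv_nonneg (convex_Icc 0 r)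
        (fun S hS => (hd S hS).continuousAt.continuousWithinAt)
        (fun S hS => (hd S (interior_subset hS)).differentiableAt.differentiableWithinAt)
        (fun S hS => by
          rw [(hd S (interior_subset hS)).deriv]
          linarith [hD2 S (interior_subset hS)]) h0r hR hR.1
      simp only [hG0] at hm
      linarith
    obtain ⟨R, hbR, hR⟩ :=
      (((hF.density_diverges r hr').eventually_ge_atTop (b + 1)).and hIoc).exists
    have h1 : p₁ ≤ F.press r R :=
      hF.eos.pressure_le_of_le (hbρ.trans (lt_add_one b)) (hbp.trans hmono) hbR
    have h2 := hG R ⟨hR.1.le, hR.2⟩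
    rw [← hF.press_mul hr' hR] at h2
    have h3 : 4 * Real.pi * F.press r R ≤ c + C * r ^ 2 / 2 := by
      have : 0 < R ^ 2 := pow_pos hR.1 2
      refine le_of_mul_le_mul_left ?_ this
      linarith
    have h4 : 0 ≤ C * r ^ 2 := mul_nonneg hM.C_pos.le (sq_nonneg r)
    have h5 : 4 * Real.pi * p₁ ≤ 4 * Real.pi * F.press r R := by gcongr
    linarith
  obtain ⟨r, h1, h2⟩ := (hle.and (eventually_mul_pow_le C two_ne_zero
    (η := 2 * Real.pi * (p₁ - p₂)) (by nlinarith))).exists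
  nlinarith

/-- Bounds for `E Ψ,r`, which follow from those on the initial surface. -/
lemma MassEstimates.eventually_E_mul_massr_le {b : ℝ} (hb : ∀ᶠ r in 𝓝[>] 0, F.ρ r r ≤ b) {η : ℝ}
    (hη : 0 < η) : ∀ᶠ r in 𝓝[>] 0, ∀ R ∈ Ioc 0 r,
      F.E r * F.massr r R ≤ (1 + η) * dEnergy F.ε F.ρbar b := by
  have hY : Tendsto (fun r => F.Y r r) (𝓝[>] 0) (𝓝 1) := by
    simpa using hF.center_regular 1 ⟨one_pos, le_rfl⟩
  -- Chosen so that `(1 + k)² ≤ (1 + η)(1 - k)`: one factor `1 + k` bounds `Y(r, r)`, the other and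
  -- `1 - k` bound the variation of `Ψ,r` with `R`.
  set k := min (η / 8) (1 / 8) with hk
  have hk0 : 0 < k := lt_min (by linarith) (by norm_num)
  have hk1 : k ≤ η / 8 := min_le_left _ _
  have hk2 : k ≤ 1 / 8 := min_le_right _ _
  filter_upwards [hM.eventually_mem, hM.eventually_massr hk0, hb,
    hY.eventually (Iio_mem_nhds (show 1 < 1 + k by linarith))] with r hr h1 h2 h3 R hR
  have hr' := hM.mem_rmax hr
  have hrr : r ∈ Ioc 0 r := ⟨hr.1, le_rfl⟩
  have hE := hF.E_pos r hr'
  have he := hF.enthalpy_pos hr' hrr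
  have h4 : F.enthalpy r r ≤ dEnergy F.ε F.ρbar b :=
    hF.eos.dEnergy_mono (hF.rhobar_lt hr' hrr) (hF.press_pos r hr' r hrr) h2
  have h5 : F.E r * F.massr r r = F.Y r r * F.enthalpy r r := by
    unfold Y; field_simp
  have h3' : F.Y r r < 1 + k := h3
  have hd := he.trans_le h4
  set d := dEnergy F.ε F.ρbar b
  have h6 : F.E r * F.massr r r ≤ (1 + k) * d := by
    rw [h5]; exact mul_le_mul h3'.le h4 he.le (by linarith)
  set A := F.E r * (3 * h / 2 * r ^ 2) with hA
  have h7 : A * (1 - k) ≤ F.E r * F.massr r r := by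
    have := mul_le_mul_of_nonneg_left (h1 r ⟨hr.1.le, le_rfl⟩).1 hE.le
    rw [hA]; linarith
  have h8 : F.E r * F.massr r R ≤ A * (1 + k) := by
    have := mul_le_mul_of_nonneg_left (h1 R ⟨hR.1.le, hR.2⟩).2 hE.le
    rw [hA]; linarith
  have h9 : (1 + k) ^ 2 ≤ (1 + η) * (1 - k) := by nlinarith
  have h10 : A * (1 + k) * (1 - k) ≤ (1 + η) * d * (1 - k) := by
    calc A * (1 + k) * (1 - k) = A * (1 - k) * (1 + k) := by ring
      _ ≤ (1 + k) * d * (1 + k) := mul_le_mul_of_nonneg_right (h7.trans h6) (by linarith)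
      _ = (1 + k) ^ 2 * d := by ring
      _ ≤ (1 + η) * (1 - k) * d := by gcongr
      _ = _ := by ring
  exact h8.trans (le_of_mul_le_mul_right h10 (by linarith))

/-- On the initial surface `Y ≥ 1/2` and `dε/dρ = (ε + p)/ρ ≥ (ε₀ + p₀)/(2b)`. Along a shell `Ψ,r`
changes by at most a factor `3`. -/
lemma MassEstimates.eventually_le_E_mul_massr {b ε₀ p₀ : ℝ} (hbρ : F.ρbar < b)
    (hb : ∀ᶠ r in 𝓝[>] 0, F.ρ r r ≤ b) (hε₀ : 0 < ε₀) (hp₀ : 0 < p₀)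
    (hε : Tendsto (fun r => F.energy r r) (𝓝[>] 0) (𝓝 ε₀))
    (hp : Tendsto (fun r => F.press r r) (𝓝[>] 0) (𝓝 p₀)) :
    ∃ k > 0, ∀ᶠ r in 𝓝[>] 0, ∀ R ∈ Ioc 0 r, k ≤ F.E r * F.massr r R := by
  have hY : Tendsto (fun r => F.Y r r) (𝓝[>] 0) (𝓝 1) := by
    simpa using hF.center_regular 1 ⟨one_pos, le_rfl⟩
  have hb0 := hF.eos.pos_of_lt hbρ
  have hh := hM.h_pos
  set k := (ε₀ + p₀) / 2 / b with hk
  have hk0 : 0 < k := by positivity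
  refine ⟨k / 6, by positivity, ?_⟩
  filter_upwards [hM.eventually_mem, hM.eventually_massr (half_pos one_pos), hb,
    hY.eventually (Ioi_mem_nhds (show (1 / 2 : ℝ) < 1 by norm_num)),
    (hε.add hp).eventually (Ioi_mem_nhds (show (ε₀ + p₀) / 2 < ε₀ + p₀ by linarith))]
    with r hr h1 h2 h3 h4 R hR
  have hr' := hM.mem_rmax hr
  have hrr : r ∈ Ioc 0 r := ⟨hr.1, le_rfl⟩
  have hE := hF.E_pos r hr'
  have he := hF.enthalpy_pos hr' hrr
  have h5 : F.E r * F.massr r r = F.Y r r * F.enthalpy r r := by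
    unfold Y; field_simp
  have h3' : 1 / 2 < F.Y r r := h3
  have h4' : (ε₀ + p₀) / 2 < F.energy r r + F.press r r := h4
  rw [F.energy_add_press] at h4'
  have h6 : k ≤ F.enthalpy r r := by
    rw [hk, div_le_iff₀ hb0]; nlinarith
  set A := F.E r * (3 * h / 2 * r ^ 2) with hA
  have h7 : F.E r * F.massr r r ≤ A * (3 / 2) := by
    have := mul_le_mul_of_nonneg_left (h1 r ⟨hr.1.le, le_rfl⟩).2 hE.le
    rw [hA]; linarith
  have h8 : A * (1 / 2) ≤ F.E r * F.massr r R := by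
    have := mul_le_mul_of_nonneg_left (h1 R ⟨hR.1.le, hR.2⟩).1 hE.le
    rw [hA]; linarith
  have h9 : 1 / 2 * k ≤ F.Y r r * F.enthalpy r r := mul_le_mul h3'.le h6 hk0.le (by linarith)
  linarith

end SphericalFluid

/-! ### Pressure, velocity and collapse time below `R = x r³` -/

namespace SphericalFluid

variable {F : SphericalFluid} {h c C δ : ℝ} {D₂ D₃ : ℝ → ℝ → ℝ}

lemma one_div_lapse_mul_u (F : SphericalFluid) (r R : ℝ) :
    1 / (F.lapse r R * F.u r R) = F.enthalpy r R / F.u r R := by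
  rw [lapse, one_div, mul_inv, inv_inv, div_eq_mul_inv]

lemma E_mul_massr_eq (hF : F.IsCollapse) {r R : ℝ} (hr : r ∈ Ioo 0 F.rmax) (hR : R ∈ Ioc 0 r) :
    F.E r * F.massr r R = F.Y r R * F.enthalpy r R := by
  have := hF.enthalpy_pos hr hR
  unfold Y; field_simp

lemma uSq_mul (F : SphericalFluid) (r : ℝ) {R : ℝ} (hR : 0 < R) :
    F.uSq r R * R = 2 * F.Ψ r R + (F.Y r R ^ 2 - 1) * R := by
  unfold uSq; field_simp; ring

variable (hF : F.IsCollapse) (hM : F.MassEstimates h c C δ D₂ D₃)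
include hF hM

/-- Since `u² > 0`, the density is bounded along `R = x r³` if `x` is large. -/
lemma MassEstimates.exists_density_le {b : ℝ} (hbρ : F.ρbar < b) (hbp : 0 < pressure F.ε F.ρbar b)
    (hb : ∀ᶠ r in 𝓝[>] 0, F.ρ r r ≤ b) :
    ∃ x > h, ∀ᶠ r in 𝓝[>] 0, F.ρ r (x * r ^ 3) ≤ b + 1 := by
  have hh := hM.h_pos
  have hlt := hF.eos.dEnergy_strictMonoOn hbρ hbp (self_mem_Ici) (show b + 1 ∈ Ici b from
    (lt_add_one b).le) (lt_add_one b)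
  have hd0 := hF.eos.dEnergy_pos hbρ
  have hb1 : F.ρbar < b + 1 := hbρ.trans (lt_add_one b)
  have hp1 := hF.eos.pressure_pos_of_le hbρ hbp (lt_add_one b).le
  set d₀ := dEnergy F.ε F.ρbar b with hd₀
  set d₁ := dEnergy F.ε F.ρbar (b + 1) with hd₁
  have hd1 : 0 < d₁ := hd0.trans hlt
  set m := (d₀ + d₁) / 2 with hm
  have hm0 : 0 < m := by positivity
  have hq : m / d₁ < 1 := by rw [div_lt_one hd1]; linarith
  have hq0 : 0 < m / d₁ := by positivity
  set θ := 1 - (m / d₁) ^ 2 with hθ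
  have hθ0 : 0 < θ := by nlinarith
  have hθ1 : θ < 1 := by nlinarith
  have hx : h < 3 * h / θ := by rw [lt_div_iff₀ hθ0]; nlinarith
  -- If `dε/dρ > d₁` on `R = x r³`, then `Y ≤ m/d₁`, that is `1 - Y² ≥ θ`. As `θ x = 3h`, `(1 - Y²)
  -- R ≥ 3h r³` exceeds `2Ψ ≤ 2h r³`, against `u² > 0`.
  refine ⟨3 * h / θ, hx, ?_⟩
  set x := 3 * h / θ with hxdef
  have hx0 : 0 < x := hh.trans hx
  filter_upwards [hM.eventually_mem, hM.eventually_mass (x := x) hh,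
    hM.eventually_E_mul_massr_le hF hb (η := (d₁ - d₀) / (2 * d₀))
      (div_pos (by linarith) (by linarith))] with r hr h1 h2
  have hr0 := hr.1
  have hr' := hM.mem_rmax hr
  have hR0 : 0 < x * r ^ 3 := by positivity
  have hR : x * r ^ 3 ∈ Ioc 0 r := ⟨hR0, h1.1.le⟩
  refine hF.eos.le_of_dEnergy_le hb1 hp1 ?_
  by_contra! hcon
  have h3 := (abs_le.1 (h1.2 _ ⟨hR0.le, le_rfl⟩)).2
  have h4 := mul_pos (hF.uSq_pos r hr' _ ⟨hR0, h1.1⟩) hR0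
  rw [F.uSq_mul r hR0] at h4
  have h5 := h2 _ hR
  rw [E_mul_massr_eq hF hr' hR, show (1 + (d₁ - d₀) / (2 * d₀)) * d₀ = m by
    rw [hm]; field_simp; ring] at h5
  have hY := hF.Y_pos hr' hR
  have h6 : F.Y r (x * r ^ 3) ≤ m / d₁ := by
    rw [le_div_iff₀ hd1]
    exact (mul_le_mul_of_nonneg_left hcon.le hY.le).trans h5
  have h7 : F.Y r (x * r ^ 3) ^ 2 ≤ 1 - θ := by
    calc F.Y r (x * r ^ 3) ^ 2 ≤ (m / d₁) ^ 2 := by gcongr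
      _ = 1 - θ := by rw [hθ]; ring
  have h8 : θ * (x * r ^ 3) = 3 * h * r ^ 3 := by rw [hxdef]; field_simp
  have h9 : 0 < h * r ^ 3 := by positivity
  nlinarith

/-- At `R = x r³` bounded density gives `Ψ,R = O(r⁶)`. Below it `Ψ,RR = O(r³)`, and integrating over
a length at most `x r³` preserves this order. -/
lemma MassEstimates.exists_press_le {b x : ℝ} (hx : 0 < x)
    (hb : ∀ᶠ r in 𝓝[>] 0, F.ρ r (x * r ^ 3) ≤ b) :
    ∃ K > 0, ∀ᶠ r in 𝓝[>] 0, ∀ R ∈ Ioc 0 (x * r ^ 3), F.press r R * R ^ 2 ≤ K * r ^ 6 := by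
  have hpi := Real.pi_gt_three
  refine ⟨max 1 (4 * Real.pi * x ^ 2 * pressure F.ε F.ρbar b + (2 * |c| * x + C) * x),
    by positivity, ?_⟩
  filter_upwards [hM.eventually_mem, hM.eventually_mass (x := x) hM.h_pos, hb] with r hr h1 h2 R hR
  have hr0 := hr.1
  have hr' := hM.mem_rmax hr
  have hx0 : 0 < x * r ^ 3 := by positivity
  have hxr : x * r ^ 3 ∈ Ioc 0 r := ⟨hx0, h1.1.le⟩
  have hRr : R ∈ Ioc 0 r := ⟨hR.1, hR.2.trans h1.1.le⟩
  have hd := (convex_Icc 0 (x * r ^ 3)).norm_image_sub_le_of_norm_hasDerivWithin_le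
    (f := F.massR r) (f' := D₂ r) (C := (2 * |c| * x + C) * r ^ 3)
    (fun S hS => (hM.hasDerivAt_massR r hr S ⟨hS.1, hS.2.trans hxr.2⟩).hasDerivWithinAt)
    (fun S hS => by
      have h3 := hM.D₂_le r hr S ⟨hS.1, hS.2.trans hxr.2⟩
      have h4 : |2 * c * S| ≤ 2 * |c| * (x * r ^ 3) := by
        rw [abs_mul, abs_mul, abs_two, abs_of_nonneg hS.1]
        gcongr
        exact hS.2
      rw [Real.norm_eq_abs]
      calc |D₂ r S| = |(D₂ r S + 2 * c * S) - 2 * c * S| := by ring_nf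
        _ ≤ |D₂ r S + 2 * c * S| + |2 * c * S| := abs_sub _ _
        _ ≤ C * r ^ 3 + 2 * |c| * (x * r ^ 3) := add_le_add h3 h4
        _ = _ := by ring) (Ioc_subset_Icc_self hR) ⟨hx0.le, le_rfl⟩
  rw [Real.norm_eq_abs, Real.norm_eq_abs] at hd
  have h5 : |x * r ^ 3 - R| ≤ x * r ^ 3 := by
    rw [abs_of_nonneg (sub_nonneg.2 hR.2)]; linarith [hR.1]
  have hC := hM.C_pos
  have h6 := (abs_le.1 (hd.trans (mul_le_mul_of_nonneg_left h5 (by positivity)))).2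
  have h7 := hF.press_mul hr' hRr
  have h8 := hF.press_mul hr' hxr
  have h9 : F.press r (x * r ^ 3) ≤ pressure F.ε F.ρbar b :=
    hF.eos.pressure_le_of_le (hF.rhobar_lt hr' hxr) (hF.press_pos r hr' _ hxr) h2
  have h10 : 4 * Real.pi * (x * r ^ 3) ^ 2 * F.press r (x * r ^ 3) ≤
      4 * Real.pi * (x * r ^ 3) ^ 2 * pressure F.ε F.ρbar b := by gcongr
  have h11 : 0 ≤ F.press r R * R ^ 2 := mul_nonneg (hF.press_pos r hr' R hRr).le (sq_nonneg R)
  calc F.press r R * R ^ 2 ≤ 4 * Real.pi * R ^ 2 * F.press r R := by nlinarith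
    _ ≤ (4 * Real.pi * x ^ 2 * pressure F.ε F.ρbar b + (2 * |c| * x + C) * x) * r ^ 6 := by
      linarith
    _ ≤ _ := by gcongr; exact le_max_right _ _

/-- Above the density `b`, dominant energy bounds `(dε/dρ)²` by a multiple of `p`, so its product
with `R²` is `O(r⁶)`. Below `b`, `dε/dρ` is bounded and `R ≤ x r³`. -/
lemma MassEstimates.exists_enthalpy_le {b x : ℝ} (hx : 0 < x) (hbρ : F.ρbar < b)
    (hbp : 0 < pressure F.ε F.ρbar b) (hdom : ∀ y ≥ b, pressure F.ε F.ρbar y ≤ F.ε y) {K : ℝ}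
    (hK : 0 < K)
    (hp : ∀ᶠ r in 𝓝[>] 0, ∀ R ∈ Ioc 0 (x * r ^ 3), F.press r R * R ^ 2 ≤ K * r ^ 6) :
    ∃ L > 0, ∀ᶠ r in 𝓝[>] 0, ∀ R ∈ Ioc 0 (x * r ^ 3), F.enthalpy r R * R ≤ L * r ^ 3 := by
  have hd := hF.eos.dEnergy_pos hbρ
  set d := dEnergy F.ε F.ρbar b with hd'
  set k := d ^ 2 / pressure F.ε F.ρbar b with hk
  have hk0 : 0 < k := by positivity
  refine ⟨d * x + Real.sqrt (k * K), by positivity, ?_⟩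
  filter_upwards [hM.eventually_mem, hM.eventually_mass (x := x) hM.h_pos, hp] with r hr h1 h2 R hR
  have hr0 := hr.1
  have hR0 := hR.1
  have hr' := hM.mem_rmax hr
  have hRr : R ∈ Ioc 0 r := ⟨hR.1, hR.2.trans h1.1.le⟩
  have hp0 := hF.press_pos r hr' R hRr
  have he := hF.enthalpy_pos hr' hRr
  have hs := Real.sqrt_nonneg (k * K)
  have hr3 : 0 < r ^ 3 := by positivity
  rcases le_total (F.ρ r R) b with hle | hle
  · have h3 : F.enthalpy r R ≤ d := hF.eos.dEnergy_mono (hF.rhobar_lt hr' hRr) hp0 hle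
    calc F.enthalpy r R * R ≤ d * (x * r ^ 3) := mul_le_mul h3 hR.2 hR0.le hd.le
      _ ≤ (d * x + Real.sqrt (k * K)) * r ^ 3 := by nlinarith
  · have h3 : F.enthalpy r R ^ 2 / F.press r R ≤ k :=
      hF.eos.dEnergy_sq_div_pressure_le hbρ hbp hle fun y hy => hdom y hy.1
    rw [div_le_iff₀ hp0] at h3
    have h4 : F.enthalpy r R * R ≤ Real.sqrt (k * K) * r ^ 3 := by
      refine le_of_sq_le_sq ?_ (by positivity)
      rw [mul_pow, mul_pow, Real.sq_sqrt (by positivity)]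
      calc F.enthalpy r R ^ 2 * R ^ 2 ≤ k * F.press r R * R ^ 2 := by gcongr
        _ = k * (F.press r R * R ^ 2) := by ring
        _ ≤ k * (K * r ^ 6) := mul_le_mul_of_nonneg_left (h2 R hR) hk0.le
        _ = _ := by ring
    nlinarith [mul_pos hd hx]

/-- Along and below `R = y r³`, where `y` is slightly larger than `h`, the velocity is bounded below
by the free fall velocity up to a factor. -/
lemma MassEstimates.exists_uSq_ge {x L k : ℝ} (hx : h < x) (hL : 0 < L) (hk : 0 < k)
    (he : ∀ᶠ r in 𝓝[>] 0, ∀ R ∈ Ioc 0 (x * r ^ 3), F.enthalpy r R * R ≤ L * r ^ 3)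
    (hE : ∀ᶠ r in 𝓝[>] 0, ∀ R ∈ Ioc 0 r, k ≤ F.E r * F.massr r R) :
    ∃ y ∈ Ioc h x, ∃ m > 0, ∀ᶠ r in 𝓝[>] 0, ∀ R ∈ Ioc 0 (y * r ^ 3), m * r ^ 3 ≤ F.uSq r R * R := by
  have hh := hM.h_pos
  set q := (k * h / (2 * L)) ^ 2 with hq
  have hq0 : 0 < q := by positivity
  -- For `(h/2) r³ ≤ R ≤ y r³` one has `Y² ≥ q`, hence `Y² R ≥ (qh/2) r³`. The excess of `y` over
  -- `h` and the mass error each cost at most `(qh/8) r³`.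
  set y := min x (h + q * h / 8) with hy
  have hyh : h < y := lt_min hx (lt_add_of_pos_right h (by positivity))
  refine ⟨y, ⟨hyh, min_le_left _ _⟩, min (h / 4) (q * h / 4), by positivity, ?_⟩
  filter_upwards [hM.eventually_mem, hM.eventually_mass (x := x) (η := min (h / 4) (q * h / 8))
    (by positivity), he, hE] with r hr h1 h2 h3 R hR
  have hr0 := hr.1
  have hR0 := hR.1
  have hr3 : 0 < r ^ 3 := by positivity
  have hRx : R ≤ x * r ^ 3 := hR.2.trans (by gcongr; exact min_le_left _ _)
  have hr' := hM.mem_rmax hr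
  have hRr : R ∈ Ioc 0 r := ⟨hR.1, hRx.trans h1.1.le⟩
  rw [F.uSq_mul r hR0]
  have h4 := (abs_le.1 (h1.2 R ⟨hR0.le, hRx⟩)).1
  -- For the smaller `R`, `2Ψ - R ≥ (h/4) r³` already, whatever `Y` is.
  rcases le_total R (h / 2 * r ^ 3) with hle | hle
  · have h5 : min (h / 4) (q * h / 4) * r ^ 3 ≤ h / 4 * r ^ 3 := by gcongr; exact min_le_left _ _
    have h6 : min (h / 4) (q * h / 8) * r ^ 3 ≤ h / 4 * r ^ 3 := by gcongr; exact min_le_left _ _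
    nlinarith [mul_nonneg (sq_nonneg (F.Y r R)) hR0.le]
  · have h5 : min (h / 4) (q * h / 4) * r ^ 3 ≤ q * h / 4 * r ^ 3 := by
      gcongr; exact min_le_right _ _
    have h6 : min (h / 4) (q * h / 8) * r ^ 3 ≤ q * h / 8 * r ^ 3 := by
      gcongr; exact min_le_right _ _
    have hY := hF.Y_pos hr' hRr
    have h7 : k * h / (2 * L) ≤ F.Y r R := by
      rw [div_le_iff₀ (by positivity)]
      have h8 := h3 R hRr
      rw [E_mul_massr_eq hF hr' hRr] at h8
      have h9 := mul_le_mul_of_nonneg_left (h2 R ⟨hR0, hRx⟩) hY.le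
      have h10 := mul_le_mul_of_nonneg_right h8 hR0.le
      have h11 := mul_le_mul_of_nonneg_left hle hk.le
      refine le_of_mul_le_mul_right ?_ hr3
      linarith
    have h8 : q ≤ F.Y r R ^ 2 := by rw [hq]; gcongr
    have h9 : R ≤ (h + q * h / 8) * r ^ 3 := hR.2.trans (by gcongr; exact min_le_right _ _)
    have h10 : q * (h / 2 * r ^ 3) ≤ F.Y r R ^ 2 * R := by gcongr
    linarith

/-- The last part of the comoving time of collapse of a shell. -/
lemma MassEstimates.exists_integral_le {y m L : ℝ} (hy : 0 < y) (hm : 0 < m) (hL : 0 < L)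
    (he : ∀ᶠ r in 𝓝[>] 0, ∀ R ∈ Ioc 0 (y * r ^ 3), F.enthalpy r R * R ≤ L * r ^ 3)
    (hu : ∀ᶠ r in 𝓝[>] 0, ∀ R ∈ Ioc 0 (y * r ^ 3), m * r ^ 3 ≤ F.uSq r R * R) :
    ∃ K, ∀ᶠ r in 𝓝[>] 0, ∀ R ∈ Ioc 0 (y * r ^ 3),
      |∫ σ in (0 : ℝ)..R, 1 / (F.lapse r σ * F.u r σ)| ≤ K * r ^ 3 := by
  refine ⟨2 * (L / Real.sqrt m) * Real.sqrt y, ?_⟩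
  filter_upwards [hM.eventually_mem, hM.eventually_mass (x := y) hM.h_pos, he, hu]
    with r hr h1 h2 h3 R hR
  have hr0 := hr.1
  have hr3 : 0 < r ^ 3 := by positivity
  have hr' := hM.mem_rmax hr
  set B := L / Real.sqrt m * Real.sqrt (r ^ 3) with hB
  have hsm := Real.sqrt_pos.2 hm
  have hsr := Real.sqrt_pos.2 hr3
  -- Here `dε/dρ ≤ L r³/σ` and `u ≥ (m r³/σ)^(1/2)`. The quotient is `O(r^(3/2) σ^(-1/2))`, whose
  -- integral up to `y r³` is `O(r³)`.
  have hbound : ∀ σ ∈ Ioc 0 R, ‖1 / (F.lapse r σ * F.u r σ)‖ ≤ B * σ ^ (-(1 / 2) : ℝ) := by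
    intro σ hσ
    have hσ' : σ ∈ Ioc 0 (y * r ^ 3) := ⟨hσ.1, hσ.2.trans hR.2⟩
    have hσr : σ ∈ Ioc 0 r := ⟨hσ.1, hσ'.2.trans h1.1.le⟩
    have hen := hF.enthalpy_pos hr' hσr
    have hsσ := Real.sqrt_pos.2 hσ.1
    have hσ2 := Real.mul_self_sqrt hσ.1.le
    have hr2 := Real.mul_self_sqrt hr3.le
    have hu1 : Real.sqrt m * Real.sqrt (r ^ 3) ≤ F.u r σ * Real.sqrt σ := by
      rw [u, ← Real.sqrt_mul hm.le, ← Real.sqrt_mul' _ hσ.1.le]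
      exact Real.sqrt_le_sqrt (h3 σ hσ')
    have hu0 : 0 < F.u r σ := by
      by_contra! hle
      have := mul_pos hsm hsr
      nlinarith
    rw [F.one_div_lapse_mul_u, Real.norm_of_nonneg (div_pos hen hu0).le,
      Real.rpow_neg hσ.1.le, ← Real.sqrt_eq_rpow, ← div_eq_mul_inv, div_le_div_iff₀ hu0 hsσ, hB,
      div_mul_eq_mul_div, div_mul_eq_mul_div, le_div_iff₀ hsm]
    have h4 := h2 σ hσ'
    have h5 : F.enthalpy r σ * Real.sqrt σ * Real.sqrt m * (Real.sqrt σ * Real.sqrt (r ^ 3)) ≤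
        L * Real.sqrt (r ^ 3) * F.u r σ * (Real.sqrt σ * Real.sqrt (r ^ 3)) := by
      calc _ = F.enthalpy r σ * (Real.sqrt σ * Real.sqrt σ) *
            (Real.sqrt m * Real.sqrt (r ^ 3)) := by ring
        _ = F.enthalpy r σ * σ * (Real.sqrt m * Real.sqrt (r ^ 3)) := by rw [hσ2]
        _ ≤ L * r ^ 3 * (F.u r σ * Real.sqrt σ) := by gcongr
        _ = L * (Real.sqrt (r ^ 3) * Real.sqrt (r ^ 3)) * (F.u r σ * Real.sqrt σ) := by rw [hr2]
        _ = _ := by ring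
    exact le_of_mul_le_mul_right h5 (by positivity)
  have h4 := intervalIntegral.norm_integral_le_of_norm_le hR.1.le
    (Eventually.of_forall hbound)
    ((intervalIntegral.intervalIntegrable_rpow' (by norm_num)).const_mul B)
  rw [Real.norm_eq_abs] at h4
  refine h4.trans ?_
  rw [intervalIntegral.integral_const_mul, integral_rpow (Or.inl (by norm_num)),
    show (-(1 / 2) + 1 : ℝ) = 1 / 2 by norm_num, Real.zero_rpow (by norm_num), ← Real.sqrt_eq_rpow]
  have h5 : Real.sqrt R ≤ Real.sqrt y * Real.sqrt (r ^ 3) := by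
    rw [← Real.sqrt_mul hy.le]; exact Real.sqrt_le_sqrt hR.2
  have h6 := Real.mul_self_sqrt hr3.le
  have hB0 : 0 < B := by positivity
  calc B * ((Real.sqrt R - 0) / (1 / 2)) = 2 * B * Real.sqrt R := by ring
    _ ≤ 2 * B * (Real.sqrt y * Real.sqrt (r ^ 3)) := by gcongr
    _ = 2 * (L / Real.sqrt m) * Real.sqrt y * (Real.sqrt (r ^ 3) * Real.sqrt (r ^ 3)) := by
      rw [hB]; ring
    _ = _ := by rw [h6]

end SphericalFluid

/-! ### Slope of null geodesics and the apparent horizon -/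

namespace SphericalFluid

variable {F : SphericalFluid} {h c C δ : ℝ} {D₂ D₃ : ℝ → ℝ → ℝ}

/-- `2Ψ/R ≥ 1` makes `u² ≥ Y²`. This supplies the lower barrier. -/
lemma IsCollapse.outgoingSlope_nonpos (hF : F.IsCollapse) {r R : ℝ} (hr : r ∈ Ioo 0 F.rmax)
    (hR : R ∈ Ioc 0 r) (hle : R ≤ 2 * F.Ψ r R) : F.outgoingSlope r R ≤ 0 := by
  have hY := hF.Y_pos hr hR
  refine mul_nonpos_of_nonneg_of_nonpos (hF.Rprime_pos hr hR).le (sub_nonpos.2 ?_)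
  rw [one_le_div hY]
  refine Real.le_sqrt_of_sq_le ?_
  have : 1 ≤ 2 * F.Ψ r R / R := (one_le_div hR.1).2 hle
  unfold uSq; linarith

lemma IsCollapse.outgoingSlope_eq_zero (hF : F.IsCollapse) {r R : ℝ} (hr : r ∈ Ioo 0 F.rmax)
    (hR : R ∈ Ioc 0 r) (he : R = 2 * F.Ψ r R) : F.outgoingSlope r R = 0 := by
  have hY := hF.Y_pos hr hR
  have h1 : 2 * F.Ψ r R / R = 1 := by rw [← he, div_self hR.1.ne']
  have h2 : F.u r R = F.Y r R := by
    rw [u, uSq, h1, add_sub_cancel_left, Real.sqrt_sq hY.le]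
  rw [outgoingSlope, h2, div_self hY.ne', sub_self, mul_zero]

/-- A lower bound for the slope of outgoing null geodesics outside the apparent horizon. -/
lemma IsCollapse.le_outgoingSlope (hF : F.IsCollapse) {r R : ℝ} (hr : r ∈ Ioo 0 F.rmax)
    (hR : R ∈ Ioo 0 r) (hle : 2 * F.Ψ r R ≤ R) :
    F.massr r R * F.enthalpy r R / (4 * Real.pi * R ^ 2 * F.ρ r R * (F.E r * F.massr r R) ^ 2) *
      ((1 - 2 * F.Ψ r R / R) / 2) ≤ F.outgoingSlope r R := by
  have hR' : R ∈ Ioc 0 r := ⟨hR.1, hR.2.le⟩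
  have hR0 := hR.1
  have hY := hF.Y_pos hr hR'
  have hρ := hF.density_pos hr hR'
  have he := hF.enthalpy_pos hr hR'
  have hm := hF.massr_pos r hr R hR'
  have hE := hF.E_pos r hr
  have hw : 2 * F.Ψ r R / R ≤ 1 := (div_le_one hR0).2 hle
  have hu0 : 0 ≤ F.u r R := Real.sqrt_nonneg _
  have husq : F.u r R ^ 2 = 2 * F.Ψ r R / R + F.Y r R ^ 2 - 1 := Real.sq_sqrt (hF.uSq_pos r hr R hR).le
  have huY : F.u r R ≤ F.Y r R := by
    refine le_of_sq_le_sq ?_ hY.le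
    rw [husq]; linarith
  -- `1 - u/Y = (1 - 2Ψ/R) / (Y (Y + u))`, and `u ≤ Y` bounds the denominator by `2Y²`.
  have h1 : (1 - 2 * F.Ψ r R / R) / 2 / F.Y r R ^ 2 ≤ 1 - F.u r R / F.Y r R := by
    rw [div_le_iff₀ (by positivity)]
    have : (1 - F.u r R / F.Y r R) * F.Y r R ^ 2 = (F.Y r R - F.u r R) * F.Y r R := by
      field_simp
    rw [this]
    nlinarith
  have h2 := mul_le_mul_of_nonneg_left h1 (hF.Rprime_pos hr hR').le
  refine le_trans (le_of_eq ?_) h2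
  rw [Rprime, F.energy_add_press, E_mul_massr_eq hF hr hR']
  field_simp

section

variable (hF : F.IsCollapse) (hM : F.MassEstimates h c C δ D₂ D₃)
include hF hM

lemma MassEstimates.eventually_lt_outgoingSlope {y K k' : ℝ} (hy : h < y) {b : ℝ}
    (hbρ : F.ρbar < b) (hbp : 0 < pressure F.ε F.ρbar b) (hb : ∀ᶠ r in 𝓝[>] 0, F.ρ r r ≤ b)
    (hp : ∀ᶠ r in 𝓝[>] 0, ∀ R ∈ Ioc 0 (y * r ^ 3), F.press r R * R ^ 2 ≤ K * r ^ 6)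
    (hk : ∀ᶠ r in 𝓝[>] 0, ∀ R ∈ Ioc 0 r, F.E r * F.massr r R ≤ k') :
    ∀ᶠ r in 𝓝[>] 0, 3 * y * r ^ 2 < F.outgoingSlope r (y * r ^ 3) := by
  have hh := hM.h_pos
  have hy0 := hh.trans hy
  have hpi := Real.pi_pos
  -- On `R = y r³` the pressure is at most `K / y²`, so the density is at most `b₂`; as `ε/ρ²`
  -- decreases, `(dε/dρ)/ρ ≥ ε/ρ² ≥ s` there.
  obtain ⟨b₂, hb2, hpb2⟩ := hM.exists_lt_pressure hF hbρ hbp hb (K / y ^ 2)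
  have hb2ρ := hbρ.trans hb2
  have hb2p := hF.eos.pressure_pos_of_le hbρ hbp hb2.le
  have hb20 := hF.eos.pos_of_lt hb2ρ
  have hεb2 := hF.eos.energy_pos hb2ρ
  set s := F.ε b₂ / b₂ ^ 2 with hs
  have hs0 : 0 < s := by positivity
  set w := (y - h) / (2 * y) with hw
  have hw0 : 0 < w := div_pos (by linarith) (by linarith)
  set k := max k' 1 with hkdef
  have hk0 : 0 < k := lt_max_of_lt_right one_pos
  -- `A / r⁴` bounds the slope from below: `Ψ,r ≥ h r²`, `R² = y² r⁶`, `E Ψ,r ≤ k` and `1 - 2Ψ/R ≥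
  -- w`.
  set A := h * s / (4 * Real.pi * y ^ 2 * k ^ 2) * (w / 2) with hA
  have hA0 : 0 < A := by positivity
  filter_upwards [hM.eventually_mem, hM.eventually_mass (x := y) (η := (y - h) / 2) (by linarith),
    hp, hk, hM.eventually_massr (η := 1 / 3) (by norm_num),
    eventually_mul_pow_le (3 * y) (n := 6) (by norm_num) (half_pos hA0)] with r hr h1 h2 h3 h4 h5
  have hr0 := hr.1
  have hr' := hM.mem_rmax hr
  set R := y * r ^ 3 with hRdef
  have hR0 : 0 < R := by positivity
  have hR : R ∈ Ioo 0 r := ⟨hR0, h1.1⟩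
  have hR' : R ∈ Ioc 0 r := ⟨hR0, h1.1.le⟩
  have hr3 : 0 < r ^ 3 := by positivity
  have h6 := (abs_le.1 (h1.2 R ⟨hR0.le, le_rfl⟩)).2
  have h7 : w ≤ 1 - 2 * F.Ψ r R / R := by
    rw [le_sub_iff_add_le, ← le_sub_iff_add_le', div_le_iff₀ hR0, hw, hRdef]
    have : (1 - (y - h) / (2 * y)) * (y * r ^ 3) = (y + h) / 2 * r ^ 3 := by field_simp; ring
    rw [this]; linarith
  have hle : 2 * F.Ψ r R ≤ R := by
    have : 2 * F.Ψ r R / R ≤ 1 := by linarith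
    exact (div_le_one hR0).1 this
  have hp1 := hF.press_pos r hr' R hR'
  have h8 : F.press r R ≤ K / y ^ 2 := by
    rw [le_div_iff₀ (by positivity)]
    have := h2 R ⟨hR0, le_rfl⟩
    have h6 : 0 < r ^ 6 := by positivity
    refine le_of_mul_le_mul_right ?_ h6
    calc F.press r R * y ^ 2 * r ^ 6 = F.press r R * R ^ 2 := by rw [hRdef]; ring
      _ ≤ _ := this
  have h9 : F.ρ r R ≤ b₂ :=
    (hF.eos.lt_of_pressure_lt hb2ρ hb2p (h8.trans_lt hpb2)).le
  have hρ := hF.density_pos hr' hR'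
  have h10 : s * F.ρ r R ≤ F.enthalpy r R := by
    have h11 := hF.eos.energy_div_sq_le (hF.rhobar_lt hr' hR') h9 fun z hz =>
      hM.dominant_of_le hF hr.2 hR hz.1
    rw [← hs, le_div_iff₀ (by positivity)] at h11
    have h12 : F.ε (F.ρ r R) = F.energy r R := rfl
    have h13 := F.energy_add_press r R
    refine le_of_mul_le_mul_right ?_ hρ
    nlinarith
  have hm0 := hF.massr_pos r hr' R hR'
  have hEm0 : 0 < F.E r * F.massr r R := mul_pos (hF.E_pos r hr') hm0
  have h14 : h * r ^ 2 ≤ F.massr r R := by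
    have := (h4 R ⟨hR0.le, hR'.2⟩).1
    linarith
  have h15 : F.E r * F.massr r R ≤ k := (h3 R hR').trans (le_max_left _ _)
  have he := hF.enthalpy_pos hr' hR'
  refine lt_of_lt_of_le ?_ (hF.le_outgoingSlope hr' hR hle)
  calc 3 * y * r ^ 2 < A / r ^ 4 := by
        rw [lt_div_iff₀ (by positivity)]
        calc 3 * y * r ^ 2 * r ^ 4 = 3 * y * r ^ 6 := by ring
          _ ≤ A / 2 := h5
          _ < A := half_lt_self hA0
    _ = h * r ^ 2 * (s * F.ρ r R) / (4 * Real.pi * R ^ 2 * F.ρ r R * k ^ 2) * (w / 2) := by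
        generalize F.ρ r R = q at hρ ⊢
        rw [hA, hRdef]; field_simp
    _ ≤ _ := by gcongr

/-- Positive pressure means `Ψ,R < 0`. Hence the horizon is unique, and the position relative to it
is read off from the sign of `R - 2Ψ`. -/
lemma MassEstimates.horizon_strictMonoOn {r : ℝ} (hr : r ∈ Ioo 0 δ) :
    StrictMonoOn (fun R => R - 2 * F.Ψ r R) (Icc 0 r) := by
  have hd : ∀ R ∈ Icc 0 r, HasDerivAt (fun R => R - 2 * F.Ψ r R) (1 - 2 * F.massR r R) R :=
    fun R hR => (hasDerivAt_id R).sub ((hM.hasDerivAt_mass_snd hr hR).const_mul 2)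
  refine strictMonoOn_of_deriv_pos (convex_Icc 0 r)
    (fun R hR => (hd R hR).continuousAt.continuousWithinAt) fun R hR => ?_
  rw [interior_Icc] at hR
  rw [(hd R (Ioo_subset_Icc_self hR)).deriv]
  linarith [hF.massR_neg (hM.mem_rmax hr) ⟨hR.1, hR.2.le⟩]

/-- The apparent horizon exists, and is close to `h r³`. -/
lemma MassEstimates.eventually_exists_horizon {y : ℝ} (hy : h < y) :
    ∀ᶠ r in 𝓝[>] 0, h / 2 * r ^ 3 < 2 * F.Ψ r (h / 2 * r ^ 3) ∧
      ∃ R₀ ∈ Ioo (h / 2 * r ^ 3) (y * r ^ 3), R₀ = 2 * F.Ψ r R₀ ∧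
        ∀ R ∈ Ioc 0 r, R = 2 * F.Ψ r R ↔ R = R₀ := by
  have hh := hM.h_pos
  filter_upwards [hM.eventually_mem, hM.eventually_mass (x := y) (η := min (h / 4) ((y - h) / 2))
    (lt_min (by linarith) (by linarith))] with r hr h1
  have hr0 := hr.1
  have hr3 : 0 < r ^ 3 := by positivity
  have h2 : min (h / 4) ((y - h) / 2) * r ^ 3 ≤ h / 4 * r ^ 3 := by gcongr; exact min_le_left _ _
  have h3 : min (h / 4) ((y - h) / 2) * r ^ 3 ≤ (y - h) / 2 * r ^ 3 := by
    gcongr; exact min_le_right _ _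
  have hyr : h / 2 * r ^ 3 ≤ y * r ^ 3 := by gcongr; linarith
  have hl0 : 0 < h / 2 * r ^ 3 := by positivity
  have hhr : 0 < h * r ^ 3 := by positivity
  have hyhr : 0 < (y - h) * r ^ 3 := mul_pos (by linarith) hr3
  have h4 := (abs_le.1 (h1.2 _ ⟨hl0.le, hyr⟩)).1
  have h5 := (abs_le.1 (h1.2 _ ⟨hl0.le.trans hyr, le_rfl⟩)).2
  have hlt : h / 2 * r ^ 3 < 2 * F.Ψ r (h / 2 * r ^ 3) := by linarith
  refine ⟨hlt, ?_⟩
  have hmono := hM.horizon_strictMonoOn hF hr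
  have hcont : ContinuousOn (fun R => R - 2 * F.Ψ r R) (Icc (h / 2 * r ^ 3) (y * r ^ 3)) :=
    continuousOn_id.sub (continuousOn_const.mul fun R hR =>
      (hM.hasDerivAt_mass_snd hr
        ⟨hl0.le.trans hR.1, hR.2.trans h1.1.le⟩).continuousAt.continuousWithinAt)
  obtain ⟨R₀, hR₀, he⟩ := intermediate_value_Ioo hyr hcont
    (show (0 : ℝ) ∈ Ioo _ _ from ⟨by linarith, by linarith⟩)
  simp only at he
  have hR₀r : R₀ ∈ Icc 0 r := ⟨hl0.le.trans hR₀.1.le, hR₀.2.le.trans h1.1.le⟩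
  refine ⟨R₀, hR₀, by linarith, fun R hR => ⟨fun hRe => ?_, fun hRe => ?_⟩⟩
  · exact hmono.injOn ⟨hR.1.le, hR.2⟩ hR₀r (by linarith)
  · rw [hRe]; linarith

end

end SphericalFluid

end

/-! ### Construction of the geodesic -/

theorem mainTheorem2 (F : SphericalFluid) (hF : F.IsCollapse) (t₀ h ε₀ p₀ : ℝ)
    (hsing : F.CentralSingularityAt t₀) (hmass : F.HasMassExpansion h ε₀ p₀) :
    F.IsLocallyNaked t₀ := by
  obtain ⟨c, C, δ, D₂, D₃, hM⟩ := hF.exists_massEstimates hmass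
  obtain ⟨hh, hε₀, hp₀, hε, hp, -⟩ := hmass
  obtain ⟨-, hint, hts⟩ := hsing
  obtain ⟨b, hbρ, hbp, hb, hdom⟩ := hM.exists_density_bound hF hε
  obtain ⟨x, hx, hbx⟩ := hM.exists_density_le hF hbρ hbp hb
  have hx0 := hh.trans hx
  obtain ⟨K, hK, hpK⟩ := hM.exists_press_le hF hx0 hbx
  obtain ⟨L, hL, heL⟩ := hM.exists_enthalpy_le hF hx0 hbρ hbp hdom hK hpK
  obtain ⟨k, hk, hkE⟩ := hM.eventually_le_E_mul_massr hF hbρ hb hε₀ hp₀ hε hp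
  obtain ⟨y, ⟨hy, hyx⟩, m, hm, hum⟩ := hM.exists_uSq_ge hF hx hL hk heL hkE
  have hy0 := hh.trans hy
  have hrestrict : ∀ᶠ r in 𝓝[>] (0 : ℝ), Ioc 0 (y * r ^ 3) ⊆ Ioc 0 (x * r ^ 3) := by
    filter_upwards [hM.eventually_mem] with r hr
    have hr0 := hr.1
    exact Ioc_subset_Ioc_right (by gcongr)
  have hslope := hM.eventually_lt_outgoingSlope hF hy hbρ hbp hb
    ((hrestrict.and hpK).mono fun r hr R hR => hr.2 R (hr.1 hR))
    (hM.eventually_E_mul_massr_le hF hb one_pos)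
  obtain ⟨T, hT⟩ := hM.exists_integral_le hF hy0 hm hL
    ((hrestrict.and heL).mono fun r hr R hR => hr.2 R (hr.1 hR)) hum
  obtain ⟨r₁, hr₁, hall⟩ := mem_nhdsGT_iff_exists_Ioo_subset.1
    (hM.eventually_mem.and <| hslope.and <| (hM.eventually_exists_horizon hF hy).and <|
      hM.eventually_mass (x := y) hh)
  have hr₁ : 0 < r₁ := hr₁
  -- Halving keeps the endpoint `r₀`, where the backward solution starts, inside the range of the
  -- estimates.
  set r₀ := r₁ / 2 with hr₀
  have hr₀0 : 0 < r₀ := half_pos hr₁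
  have hmem : ∀ r ∈ Ioc 0 r₀, r ∈ Ioo 0 r₁ := fun r hr => ⟨hr.1, hr.2.trans_lt (half_lt_self hr₁)⟩
  have hδ : ∀ r ∈ Ioc 0 r₀, r ∈ Ioo 0 δ := fun r hr => (hall (hmem r hr)).1
  have hsl : ∀ r ∈ Ioc 0 r₀, 3 * y * r ^ 2 < F.outgoingSlope r (y * r ^ 3) :=
    fun r hr => (hall (hmem r hr)).2.1
  have hyr : ∀ r ∈ Ioc 0 r₀, y * r ^ 3 < r := fun r hr => (hall (hmem r hr)).2.2.2.1
  have hzr : ∀ r ∈ Ioc 0 r₀, h / 2 * r ^ 3 < 2 * F.Ψ r (h / 2 * r ^ 3) :=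
    fun r hr => (hall (hmem r hr)).2.2.1.1
  have hhor := fun r hr => (hall (hmem r hr)).2.2.1.2
  choose! Rh hRh hRh0 hRhu using hhor
  have hlu : ∀ r ∈ Ioc 0 r₀, h / 2 * r ^ 3 < y * r ^ 3 := fun r hr => (hRh r hr).1.trans (hRh r hr).2
  have hl0 : ∀ r ∈ Ioc 0 r₀, 0 < h / 2 * r ^ 3 := fun r hr => by
    have := hr.1
    positivity
  have hreg : ∀ p ∈ {p : ℝ × ℝ | p.1 ∈ Ioc 0 r₀ ∧ p.2 ∈ Icc (h / 2 * p.1 ^ 3) (y * p.1 ^ 3)},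
      p.1 < δ ∧ p.2 ∈ Ioo 0 p.1 := fun p hp =>
    ⟨(hδ p.1 hp.1).2, (hl0 p.1 hp.1).trans_le hp.2.1, hp.2.2.trans_lt (hyr p.1 hp.1)⟩
  have hr₀m : r₀ ∈ Ioc 0 r₀ := ⟨hr₀0, le_rfl⟩
  have hcube : ∀ a t : ℝ, HasDerivAt (fun t => a * t ^ 3) (a * (3 * t ^ 2)) t := fun a t => by
    simpa using (hasDerivAt_pow 3 t).const_mul a
  -- The starting value is midway between the horizon and the upper cubic, so the curve starts
  -- outside the horizon.
  obtain ⟨Rg, hRg0, hRgc, hRg⟩ := exists_solution_between (f := F.outgoingSlope)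
    (f' := F.outgoingSlopeR) (l := fun r => h / 2 * r ^ 3) (u := fun r => y * r ^ 3)
    (x₀ := (Rh r₀ + y * r₀ ^ 3) / 2) hr₀0 (hcube _) (hcube _) hlu
    (fun p hp => (hM.continuousAt_outgoingSlope hF (hreg p hp).1
      (hreg p hp).2).continuousWithinAt)
    (fun p hp => (hM.continuousAt_outgoingSlopeR hF (hreg p hp).1
      (hreg p hp).2).continuousWithinAt)
    (fun t ht R hR => hM.hasDerivAt_outgoingSlope hF (hreg (t, R) ⟨ht, hR⟩).1
      (hreg (t, R) ⟨ht, hR⟩).2)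
    (fun t ht => by
      have := hF.outgoingSlope_nonpos (hM.mem_rmax (hδ t ht))
        ⟨hl0 t ht, (hlu t ht).le.trans (hyr t ht).le⟩ (hzr t ht).le
      have h0 := ht.1
      exact this.trans_lt (by positivity))
    (fun t ht => by linarith [hsl t ht])
    (by linarith [(hRh r₀ hr₀m).1, (hRh r₀ hr₀m).2]) (by linarith [(hRh r₀ hr₀m).2])
  have hIoo : ∀ r ∈ Ioo 0 r₀, r ∈ Ioc 0 r₀ := fun r hr => ⟨hr.1, hr.2.le⟩
  have hRgr : ∀ r ∈ Ioo 0 r₀, Rg r ∈ Ioo 0 r := fun r hr =>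
    ⟨(hl0 r (hIoo r hr)).trans (hRg r hr).1.1, (hRg r hr).1.2.trans (hyr r (hIoo r hr))⟩
  have hRhr : ∀ r ∈ Ioc 0 r₀, Rh r ∈ Ioo 0 r := fun r hr =>
    ⟨(hl0 r hr).trans (hRh r hr).1, (hRh r hr).2.trans (hyr r hr)⟩
  have hRg₀ : Rg r₀ ∈ Ioo (Rh r₀) (y * r₀ ^ 3) := by
    rw [hRg0]
    constructor <;> linarith [(hRh r₀ hr₀m).2]
  have hRgr' : ∀ r ∈ Ioc 0 r₀, Rg r ∈ Ioo 0 r := by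
    intro r hr
    rcases hr.2.lt_or_eq with hlt | he
    · exact hRgr r ⟨hr.1, hlt⟩
    · rw [he]
      exact ⟨(hRhr r₀ hr₀m).1.trans hRg₀.1, hRg₀.2.trans (hyr r₀ hr₀m)⟩
  have han : ∀ r ∈ Ioc 0 r₀, AnalyticAt ℝ (fun x : ℝ × ℝ => F.Ψ x.1 x.2) (r, Rg r) := fun r hr =>
    hM.analytic r (hδ r hr) _ (Ioo_subset_Icc_self (hRgr' r hr))
  -- At a zero of `R - 2Ψ` the slope vanishes, and the derivative along the curve is `-2Ψ,r < 0`.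
  have hbarrier := pos_of_deriv_neg_of_eq_zero (D := fun r => Rg r - 2 * F.Ψ r (Rg r))
    (D' := fun r => F.outgoingSlope r (Rg r) -
      2 * (F.massr r (Rg r) + F.outgoingSlope r (Rg r) * F.massR r (Rg r))) (b := r₀)
    (hRgc.sub (continuousOn_const.mul fun r hr =>
      ((han r hr).continuousAt.comp_continuousWithinAt (f := fun r => (r, Rg r)) (x := r)
        (continuousWithinAt_id.prodMk (hRgc r hr)))))
    (by
      have := hM.horizon_strictMonoOn hF (hδ r₀ hr₀m) (Ioo_subset_Icc_self (hRhr r₀ hr₀m))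
        (Ioo_subset_Icc_self (hRgr' r₀ hr₀m)) hRg₀.1
      dsimp only at this ⊢
      linarith [hRh0 r₀ hr₀m])
    (fun r hr h0 => by
      have hr' := hM.mem_rmax (hδ r (hIoo r hr))
      have hR := Ioo_subset_Ioc_self (hRgr r hr)
      rw [hF.outgoingSlope_eq_zero hr' hR (by linarith)]
      linarith [hF.massr_pos r hr' _ hR])
    (fun r hr => by
      have ha := han r (hIoo r hr)
      have h1 := ha.differentiableAt.hasFDerivAt.comp_hasDerivAt (f := fun s => (s, Rg s)) r
        ((hasDerivAt_id r).prodMk (hRg r hr).2)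
      refine ((hRg r hr).2.sub (h1.const_mul 2)).congr_deriv ?_
      have h2 : ((1 : ℝ), F.outgoingSlope r (Rg r)) =
          (1, 0) + F.outgoingSlope r (Rg r) • ((0 : ℝ), (1 : ℝ)) := by simp
      have h3 : F.massr r (Rg r) = _ := ha.hasDerivAt_fst.deriv
      have h4 : F.massR r (Rg r) = _ := ha.hasDerivAt_snd.deriv
      rw [h2, map_add, map_smul, h3, h4, smul_eq_mul])
  have hδr : r₀ ∈ Ioc 0 F.rmax := ⟨hr₀0, (hM.mem_rmax (hδ r₀ hr₀m)).2.le⟩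
  refine ⟨r₀, hδr, Rh, Rg, ?_, fun r hr => ⟨hRgr r hr, (hRg r hr).2⟩, ⟨?_, ?_⟩, ?_⟩
  · exact fun r hr => ⟨Ioo_subset_Ioc_self (hRhr r (hIoo r hr)), hRhu r (hIoo r hr)⟩
  · refine tendsto_of_tendsto_of_tendsto_of_le_of_le' tendsto_const_nhds
      (tendsto_id.mono_left nhdsWithin_le_nhds) ?_ ?_
    · filter_upwards [Ioo_mem_nhdsGT hr₀0] with r hr using (hRgr r hr).1.le
    · filter_upwards [Ioo_mem_nhdsGT hr₀0] with r hr using (hRgr r hr).2.le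
  -- The comoving time along the curve is `t_s(r)` minus this integral.
  · have hzero : Tendsto (fun r => ∫ σ in (0 : ℝ)..Rg r, 1 / (F.lapse r σ * F.u r σ)) (𝓝[>] 0)
        (𝓝 0) := by
      have h1 : Tendsto (fun r : ℝ => T * r ^ 3) (𝓝[>] 0) (𝓝 (T * 0 ^ 3)) :=
        ((continuous_const.mul (continuous_id.pow 3)).tendsto 0).mono_left nhdsWithin_le_nhds
      rw [zero_pow three_ne_zero, mul_zero] at h1
      refine squeeze_zero_norm' ?_ h1
      filter_upwards [Ioo_mem_nhdsGT hr₀0, hT] with r hr hTr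
      exact hTr _ ⟨(hRgr r hr).1, (hRg r hr).1.2.le⟩
    have h2 := hts.sub hzero
    rw [sub_zero] at h2
    refine h2.congr' ?_
    filter_upwards [Ioo_mem_nhdsGT hr₀0] with r hr
    have hi := hint r (hM.mem_rmax (hδ r (hIoo r hr)))
    have hR := hRgr r hr
    have hi1 := hi.mono_set (c := 0) (d := Rg r) (by
      rw [uIcc_of_le hR.1.le, uIcc_of_le hr.1.le]; exact Icc_subset_Icc_right hR.2.le)
    simp only [SphericalFluid.singularTime, SphericalFluid.comovingTime]
    exact intervalIntegral.integral_interval_sub_left hi hi1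
  · intro r hr
    by_contra! hle
    have h1 := hM.horizon_strictMonoOn hF (hδ r (hIoo r hr)) |>.monotoneOn
      (Ioo_subset_Icc_self (hRgr r hr)) (Ioo_subset_Icc_self (hRhr r (hIoo r hr))) hle
    have h2 := hbarrier r (hIoo r hr)
    linarith [hRh0 r (hIoo r hr)]
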